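/- **Setting.** Let $M=8\binom n3$ be the number of 3-clauses (three literals on three distinct variables) over the variables $x_1,\dots,x_n$. The random satisfiable formula $F^*\sim\mathcal P^{\rm sat}_{n,p}$ is generated as follows: order all $M$ clauses uniformly at random; starting from the empty formula scan them in this order; for each clause toss an independent coin with success probability $p$, and include the clause if its coin toss is successful and the formula remains satisfiable after adding it. "Whp" means with probability $1-o(m^{-1/2})$ as $n\to\infty$, where $m=pM$. **Definitions.** Let $F$ be a CNF formula on $n$ variables and $\psi$ an assignment. - $F$ is *$\rho$-proportional* if there is no non-empty set $U$ of variables with $|U|\le n/10^6$ such that at least $\rho|U|$ clauses of $F$ contain at least two variables of $U$. - $F[Z]$ is the set of clauses of $F$ all of whose variables lie in $Z$. A variable $x$ *supports* a clause w.r.t. $\psi$ if its literal is the only literal of the clause that is true under $\psi$. - A set $H$ of variables is a *$t$-core* of $F$ w.r.t. $\psi$ if every $x\in H$ supports at least $t$ clauses of $F[H]$ w.r.t. $\psi$ and appears in at most $t/3$ clauses of $F\setminus F[H]$. (A union of $t$-cores w.r.t. the same $\psi$ is a $t$-core, so there is a unique maximal one.) - Given $H$ and $\psi$, the variables of $H$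 are the $0$-satellites; for $i\ge1$, $x$ is an *$i$-satellite* if $F$ contains a clause consisting of a literal of $x$ and two literals that are false under $\psi$, whose variables are a $b$- and a $b'$-satellite with $b,b'<i$ and $\max(b,b')=i-1$. The *satellite variables* are the $i$-satellites with $i\ge1$. - A set of variables is *frozen* in $F$ if each of its variables takes the same value in all satisfying assignments of $F$. - $F_{out}(A,\psi)$ is obtained from $F$ by setting the variables of $A$ according to $\psi$, removing all clauses with a true literal, and removing the false literals from the other clauses. The connected components of a formula are those of the graph on its variables in which two variables are adjacent if some clause contains both; the size of a component is its number of variables. **Proposition.** There are constants $d,c>0$ and a function $t=t(n,p)$ with positive integer values such that, for every $p=p(n)\le1$ with $n^2p\ge d$ (for all large $n$), whp the following holds: there are a satisfying assignment $\psi$ of $F^*$ and a set $H$ of variables that is the maximal $t$-core of $F^*$ w.r.t. $\psi$, such that 1. $|H|\ge(1-e^{-c\,n^2p})\,n$; 2. $F^*$ is $t/10$-proportional; 3. $H\cup S$ is frozen in $F^*$, where $S$ is the set of satellite variables of $H$ w.r.t. $\psi$; 4. every connected component of $F^*_{out}(H\cup S,\psi)$ has size at most $\log n$ (natural logarithm).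 -/

import Mathlib

open Filter Asymptotics

namespace RandomSat

/-- A literal over the variables `x_0, …, x_{n-1}`: `(x, true)` is the literal `x` and
`(x, false)` is its negation. -/
abbrev Literal (n : ℕ) := Fin n × Bool

/-- A clause is the disjunction of a finite set of literals. -/
abbrev Clause (n : ℕ) := Finset (Literal n)

/-- A CNF formula is the conjunction of a finite set of clauses. -/
abbrev Formula (n : ℕ) := Finset (Clause n)

abbrev Assignment (n : ℕ) := Fin n → Bool

/-- The set of variables that appear (positively or negatively) in a clause. -/
def Clause.vars {n : ℕ} (C : Clause n) : Finset (Fin n) := C.image Prod.fst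

/-- The literal `l` evaluates to TRUE under `ψ`. -/
def LitTrue {n : ℕ} (ψ : Assignment n) (l : Literal n) : Prop := ψ l.1 = l.2

/-- `ψ` satisfies `F`: every clause of `F` contains a TRUE literal. -/
def Satisfies {n : ℕ} (ψ : Assignment n) (F : Formula n) : Prop :=
  ∀ C ∈ F, ∃ l ∈ C, LitTrue ψ l

def Satisfiable {n : ℕ} (F : Formula n) : Prop := ∃ ψ : Assignment n, Satisfies ψ F

/-! ### The random satisfiable 3CNF process -/

/-- All `8 * n.choose 3` possible 3-clauses: three literals on three distinct variables. -/
def allClauses (n : ℕ) : Finset (Clause n) :=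
  (Finset.powersetCard 3 (Finset.univ : Finset (Literal n))).filter (fun C => C.vars.card = 3)

/-- An ordering (permutation) of all the 3-clauses. -/
abbrev ClauseOrder (n : ℕ) := Fin (allClauses n).card ≃ {C : Clause n // C ∈ allClauses n}

/-- One step of the scan: a clause whose coin toss was successful (i.e. that lies in `S`) is added
to the current formula if the formula stays satisfiable, otherwise the formula is unchanged. -/
noncomputable def satStep {n : ℕ} (S : Finset (Clause n)) (F : Formula n) (C : Clause n) :
    Formula n :=
  open Classical in if C ∈ S ∧ Satisfiable (insert C F) then insert C F else F

/-- The formula obtained by scanning all clauses in the order `σ`, starting from the empty formula,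
where `S` is the set of clauses whose coin toss was successful. -/
noncomputable def satFormula {n : ℕ} (σ : ClauseOrder n) (S : Finset (Clause n)) : Formula n :=
  (List.ofFn (fun i => (σ i).1)).foldl (satStep S) ∅

/-- The probability that the random satisfiable formula `F*` has the property `A`, where the
order `σ` is uniformly random and, independently, each of the clauses is tossed successfully with
probability `p`, independently of the others. -/
noncomputable def satProb (n : ℕ) (p : ℝ) (A : Set (Formula n)) : ℝ :=
  open Classical in
  (∑ σ : ClauseOrder n, ∑ S ∈ (allClauses n).powerset,
    p ^ S.card * (1 - p) ^ ((allClauses n).card - S.card) *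
      (if satFormula σ S ∈ A then 1 else 0)) / (Fintype.card (ClauseOrder n) : ℝ)

/-! ### Proportionality, cores, satellites -/

/-- `F` is `ρ`-proportional: there is no non-empty set `U` of at most `n / 10^6` variables such that
at least `ρ * |U|` clauses of `F` contain at least two variables from `U`. -/
def IsProportional {n : ℕ} (F : Formula n) (ρ : ℝ) : Prop :=
  ¬ ∃ U : Finset (Fin n), U.Nonempty ∧ (U.card : ℝ) ≤ (n : ℝ) / 10 ^ 6 ∧
    ρ * (U.card : ℝ) ≤ ((F.filter (fun C => 2 ≤ (C.vars ∩ U).card)).card : ℝ)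

/-- `F[Z]`: the clauses of `F` all of whose variables belong to `Z`. -/
def Formula.restrict {n : ℕ} (F : Formula n) (Z : Finset (Fin n)) : Formula n :=
  F.filter (fun C => C.vars ⊆ Z)

/-- `x` supports the clause `C` w.r.t. `ψ`: `x` is the only variable whose literal in `C`
evaluates to TRUE. -/
def Supports {n : ℕ} (ψ : Assignment n) (x : Fin n) (C : Clause n) : Prop :=
  ∃ l ∈ C, l.1 = x ∧ LitTrue ψ l ∧ ∀ l' ∈ C, LitTrue ψ l' → l' = l

open Classical in
/-- `Z` is `t`-expanding in `F` w.r.t. `ψ`. -/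
def IsExpanding {n : ℕ} (F : Formula n) (ψ : Assignment n) (t : ℕ) (Z : Finset (Fin n)) : Prop :=
  ∀ x ∈ Z, t ≤ ((F.restrict Z).filter (fun C => Supports ψ x C)).card

/-- `Z` is `r`-self-contained in `F`. -/
def IsSelfContained {n : ℕ} (F : Formula n) (r : ℝ) (Z : Finset (Fin n)) : Prop :=
  ∀ x ∈ Z, (((F \ F.restrict Z).filter (fun C => x ∈ C.vars)).card : ℝ) ≤ r

/-- `H` is a `t`-core of `F` w.r.t. `ψ`. -/
def IsCore {n : ℕ} (F : Formula n) (ψ : Assignment n) (t : ℕ) (H : Finset (Fin n)) : Prop :=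
  IsExpanding F ψ t H ∧ IsSelfContained F ((t : ℝ) / 3) H

/-- `H` is the maximal `t`-core of `F` w.r.t. `ψ` (`t`-cores w.r.t. the same `ψ` are closed under
unions, so a maximal one is the largest one). -/
def IsMaximalCore {n : ℕ} (F : Formula n) (ψ : Assignment n) (t : ℕ) (H : Finset (Fin n)) : Prop :=
  IsCore F ψ t H ∧ ∀ H' : Finset (Fin n), IsCore F ψ t H' → H' ⊆ H

/-- `IsSatellite F φ H i x`: the variable `x` is an `i`-satellite w.r.t. `H`. In `step`, `l` is
the literal of `x`, and `l₁`, `l₂` are the two other literals of the clause, both FALSE under `φ`;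
the variable of `l₁` is an `i`-satellite and that of `l₂` is a `b`-satellite with `b < i + 1`. -/
inductive IsSatellite {n : ℕ} (F : Formula n) (φ : Assignment n) (H : Finset (Fin n)) :
    ℕ → Fin n → Prop
  | core (x : Fin n) (hx : x ∈ H) : IsSatellite F φ H 0 x
  | step (i b : ℕ) (l l₁ l₂ : Literal n) (hb : b ≤ i)
      (h_mem : ({l, l₁, l₂} : Clause n) ∈ F)
      (h_ne₁ : l.1 ≠ l₁.1) (h_ne₂ : l.1 ≠ l₂.1) (h_ne : l₁.1 ≠ l₂.1)
      (h_false₁ : ¬ LitTrue φ l₁) (h_false₂ : ¬ LitTrue φ l₂)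
      (h_sat₁ : IsSatellite F φ H i l₁.1) (h_sat₂ : IsSatellite F φ H b l₂.1) :
      IsSatellite F φ H (i + 1) l.1

open Classical in
/-- The set of satellite variables. -/
noncomputable def satellites {n : ℕ} (F : Formula n) (φ : Assignment n) (H : Finset (Fin n)) :
    Finset (Fin n) :=
  Finset.univ.filter (fun x => ∃ b : ℕ, 1 ≤ b ∧ IsSatellite F φ H b x)

/-- Every variable of `A` takes the same value in all satisfying assignments of `F`. -/
def IsFrozen {n : ℕ} (F : Formula n) (A : Finset (Fin n)) : Prop :=
  ∀ x ∈ A, ∀ φ₁ φ₂ : Assignment n, Satisfies φ₁ F → Satisfies φ₂ F → φ₁ x = φ₂ x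

/-! ### The simplified formula and its connected components -/

open Classical in
/-- `F_out(A, φ)`: set the variables of `A` according to `φ`, remove every clause with a TRUE
literal, and remove the FALSE literals from the other clauses. -/
noncomputable def Formula.out {n : ℕ} (F : Formula n) (A : Finset (Fin n)) (φ : Assignment n) :
    Formula n :=
  (F.filter (fun C => ¬ ∃ l ∈ C, l.1 ∈ A ∧ LitTrue φ l)).image
    (fun C => C.filter (fun l => l.1 ∉ A))

/-- The graph induced by `F`: the vertices are the variables, two of which are adjacent if some
clause of `F` contains them both. -/
def Formula.graph {n : ℕ} (F : Formula n) : SimpleGraph (Fin n) where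
  Adj x y := x ≠ y ∧ ∃ C ∈ F, x ∈ C.vars ∧ y ∈ C.vars
  symm := ⟨fun _ _ h => ⟨h.1.symm, h.2.imp fun _ hC => ⟨hC.1, hC.2.2, hC.2.1⟩⟩⟩
  loopless := ⟨fun _ h => h.1 rfl⟩

/-- Every connected component of `F` has at most `r` variables. -/
def ComponentsAtMost {n : ℕ} (F : Formula n) (r : ℝ) : Prop :=
  ∀ K : F.graph.ConnectedComponent, (K.supp.ncard : ℝ) ≤ r

end RandomSat

open RandomSat

namespace RandomSat

/-! Fix the order and let `S` be the set of clauses with successful tosses. If `ψ` satisfies the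
outcome, every successful clause true under `ψ` is accepted, so the outcome is exactly `S ∩
trueClauses ψ` (`satFormula_eq_inter`). It thus resembles a planted formula, except that `ψ` depends
on `S`.

This dependence is removed by taking `ψ` uniform among the solutions of the outcome. For a fixed
`ψ`, the weight 1/(number of solutions) on the event that `ψ` is a solution increases with the set
of successful clauses true under `ψ`: more of them only help to reject false clauses, and they leave
fewer solutions. Having few supported clauses is a decreasing property, so Harris' inequality,
conditionally on the tosses of the clauses false under `ψ`, bounds it as in the planted model; the
weights then sum to 1 over `ψ` (`sum_binExp_solutionWeight_le`). With D = n²p and t about D/20, the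
probability that all clauses of `T` occur while all variables of `K` support fewer than 2t clauses
is at most p^|T| · exp(-D|K|/10).

The rest is deterministic (`exists_core_structure`). Let B₀ be the variables supporting fewer than
2t clauses, and enlarge it to B by repeatedly adding variables that share more than t/3 clauses with
the current set. The complement of B is a t-core. Proportionality forces at least 2/5 of B, and of
each connected component of B, to come from B₀. Hence B is small once B₀ is, and a component larger
than log n yields a connected set `T` of clauses with at least 2|T|/5 variables of B₀, which a
first-moment count excludes (`sum_treeWitness_le`).

For frozenness, a union bound over pairs shows that all solutions are close to each other. If a
solution differs from `ψ` on a few core variables, each of these supports t clauses inside the core,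
each needing a second flipped core variable, against proportionality. Satellites follow by unit
propagation. The total failure probability is at most 5/n², while m ≤ 8n³. -/

open Classical in
/-- The indicator of a proposition. -/
noncomputable def ind (P : Prop) : ℝ := if P then 1 else 0

theorem ind_pos {P : Prop} (h : P) : ind P = 1 := if_pos h

theorem ind_neg {P : Prop} (h : ¬ P) : ind P = 0 := if_neg h

theorem ind_nonneg (P : Prop) : 0 ≤ ind P := by
  unfold ind
  split_ifs
  exacts [zero_le_one, le_rfl]

theorem ind_le {P : Prop} {a : ℝ} (ha : 0 ≤ a) (h : P → 1 ≤ a) : ind P ≤ a := by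
  unfold ind
  split_ifs with hP
  exacts [h hP, ha]

/-! ### Expectation over a binomial random subset -/

section Binomial

variable {α : Type*}

/-- The probability that the binomial random subset of `A` equals `S`. -/
noncomputable def binWeight (p : ℝ) (A S : Finset α) : ℝ :=
  p ^ S.card * (1 - p) ^ (A.card - S.card)

/-- The expectation of `f` over the binomial random subset of `A`. -/
noncomputable def binExp (p : ℝ) (A : Finset α) (f : Finset α → ℝ) : ℝ :=
  ∑ S ∈ A.powerset, binWeight p A S * f S

theorem binWeight_nonneg {p : ℝ} (h0 : 0 ≤ p) (h1 : p ≤ 1) (A S : Finset α) :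
    0 ≤ binWeight p A S :=
  mul_nonneg (pow_nonneg h0 _) (pow_nonneg (by linarith) _)

theorem binExp_mono {p : ℝ} (h0 : 0 ≤ p) (h1 : p ≤ 1) {A : Finset α} {f g : Finset α → ℝ}
    (h : ∀ S ⊆ A, f S ≤ g S) : binExp p A f ≤ binExp p A g :=
  Finset.sum_le_sum fun S hS =>
    mul_le_mul_of_nonneg_left (h S (Finset.mem_powerset.1 hS)) (binWeight_nonneg h0 h1 A S)

theorem binExp_congr {p : ℝ} {A : Finset α} {f g : Finset α → ℝ}
    (h : ∀ S ⊆ A, f S = g S) : binExp p A f = binExp p A g :=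
  Finset.sum_congr rfl fun S hS => by rw [h S (Finset.mem_powerset.1 hS)]

theorem binExp_nonneg {p : ℝ} (h0 : 0 ≤ p) (h1 : p ≤ 1) {A : Finset α} {f : Finset α → ℝ}
    (h : ∀ S ⊆ A, 0 ≤ f S) : 0 ≤ binExp p A f :=
  Finset.sum_nonneg fun S hS =>
    mul_nonneg (binWeight_nonneg h0 h1 A S) (h S (Finset.mem_powerset.1 hS))

theorem binExp_sum {ι : Type*} (p : ℝ) (A : Finset α) (s : Finset ι) (f : ι → Finset α → ℝ) :
    binExp p A (fun S => ∑ i ∈ s, f i S) = ∑ i ∈ s, binExp p A (f i) := by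
  simp only [binExp, Finset.mul_sum]
  exact Finset.sum_comm

theorem binExp_add (p : ℝ) (A : Finset α) (f g : Finset α → ℝ) :
    binExp p A (fun S => f S + g S) = binExp p A f + binExp p A g := by
  simp only [binExp, mul_add, Finset.sum_add_distrib]

theorem binExp_sub (p : ℝ) (A : Finset α) (f g : Finset α → ℝ) :
    binExp p A (fun S => f S - g S) = binExp p A f - binExp p A g := by
  simp only [binExp, mul_sub, Finset.sum_sub_distrib]

theorem binExp_const_mul (p c : ℝ) (A : Finset α) (f : Finset α → ℝ) :
    binExp p A (fun S => c * f S) = c * binExp p A f := by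
  simp only [binExp, Finset.mul_sum]
  exact Finset.sum_congr rfl fun S _ => by ring

theorem binExp_mul_const (p c : ℝ) (A : Finset α) (f : Finset α → ℝ) :
    binExp p A (fun S => f S * c) = binExp p A f * c := by
  simp only [binExp, Finset.sum_mul]
  exact Finset.sum_congr rfl fun S _ => by ring

variable [DecidableEq α]

/-- Independence of the tosses, as the expansion of a product of binomials; the generating function
and the containment probability below are special cases. -/
theorem binExp_prod (p : ℝ) (A : Finset α) (f g : α → ℝ) :
    binExp p A (fun S => (∏ i ∈ S, f i) * ∏ i ∈ A \ S, g i) =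
      ∏ i ∈ A, (p * f i + (1 - p) * g i) := by
  rw [Finset.prod_add]
  refine Finset.sum_congr rfl fun S hS => ?_
  rw [Finset.prod_mul_distrib, Finset.prod_mul_distrib, Finset.prod_const, Finset.prod_const,
    Finset.card_sdiff_of_subset (Finset.mem_powerset.1 hS), binWeight]
  ring

theorem binExp_pow_card_inter (p y : ℝ) (A Q : Finset α) :
    binExp p A (fun S => y ^ (S ∩ Q).card) = (1 - p + p * y) ^ (A ∩ Q).card := by
  have h := binExp_prod p A (fun i => if i ∈ Q then y else 1) (fun _ => 1)
  have e : ∀ S : Finset α, ∏ i ∈ S, (if i ∈ Q then y else 1) = y ^ (S ∩ Q).card := fun S => by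
    rw [Finset.prod_ite, Finset.prod_const_one, mul_one, Finset.prod_const,
      Finset.filter_mem_eq_inter]
  simp only [e, Finset.prod_const_one, mul_one] at h
  rw [h, ← Finset.filter_mem_eq_inter, ← Finset.prod_const, Finset.prod_filter]
  exact Finset.prod_congr rfl fun i _ => by split_ifs <;> ring

theorem binExp_one (p : ℝ) (A : Finset α) : binExp p A (fun _ => 1) = 1 := by
  have h := binExp_pow_card_inter p 1 A ∅
  simpa using h

theorem binExp_subset (p : ℝ) {A T : Finset α} (hT : T ⊆ A) :
    binExp p A (fun S => if T ⊆ S then 1 else 0) = p ^ T.card := by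
  have h := binExp_prod p A (fun _ => 1) (fun i => if i ∈ T then 0 else 1)
  have e : ∏ i ∈ A, (p * 1 + (1 - p) * (if i ∈ T then 0 else 1)) = p ^ T.card := by
    conv_rhs => rw [← Finset.inter_eq_right.2 hT, ← Finset.filter_mem_eq_inter,
      ← Finset.prod_const, Finset.prod_filter]
    exact Finset.prod_congr rfl fun i _ => by split_ifs <;> ring
  rw [← e, ← h]
  refine binExp_congr fun S hS => ?_
  rw [Finset.prod_const_one, one_mul]
  split_ifs with hTS
  · symm
    refine Finset.prod_eq_one fun i hi => if_neg fun hiT => ?_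
    exact (Finset.mem_sdiff.1 hi).2 (hTS hiT)
  · obtain ⟨i, hi, hiS⟩ := Finset.not_subset.1 hTS
    symm
    exact Finset.prod_eq_zero (Finset.mem_sdiff.2 ⟨hT hi, hiS⟩) (if_pos hi)

/-- Fubini for independent tosses. It permits conditioning on the tosses of the clauses false under
`ψ`. -/
theorem binExp_union (p : ℝ) {A₁ A₂ : Finset α} (h : Disjoint A₁ A₂) (f : Finset α → ℝ) :
    binExp p (A₁ ∪ A₂) f = binExp p A₂ (fun W => binExp p A₁ (fun G => f (G ∪ W))) := by
  simp only [binExp, Finset.mul_sum]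
  rw [← Finset.sum_product']
  symm
  refine Finset.sum_bij' (fun x _ => x.2 ∪ x.1) (fun S _ => (S ∩ A₂, S ∩ A₁)) ?_ ?_ ?_ ?_ ?_
  · rintro ⟨W, G⟩ hx
    simp only [Finset.mem_product, Finset.mem_powerset] at hx ⊢
    exact Finset.union_subset_union hx.2 hx.1
  · intro S _
    simp only [Finset.mem_product, Finset.mem_powerset]
    exact ⟨Finset.inter_subset_right, Finset.inter_subset_right⟩
  · rintro ⟨W, G⟩ hx
    simp only [Finset.mem_product, Finset.mem_powerset] at hx
    have h1 : G ∩ A₂ = ∅ := Finset.disjoint_iff_inter_eq_empty.1 (h.mono_left hx.2)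
    have h2 : W ∩ A₁ = ∅ := Finset.disjoint_iff_inter_eq_empty.1 (h.symm.mono_left hx.1)
    simp only [Finset.union_inter_distrib_right, h1, h2, Finset.inter_eq_left.2 hx.1,
      Finset.inter_eq_left.2 hx.2, Finset.empty_union, Finset.union_empty]
  · intro S hS
    rw [Finset.mem_powerset] at hS
    simp only [← Finset.inter_union_distrib_left]
    exact Finset.inter_eq_left.2 hS
  · rintro ⟨W, G⟩ hx
    simp only [Finset.mem_product, Finset.mem_powerset] at hx
    have hd : Disjoint G W := Finset.disjoint_of_subset_left hx.2
      (Finset.disjoint_of_subset_right hx.1 h)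
    have e : A₁.card + A₂.card - (G.card + W.card) =
        (A₁.card - G.card) + (A₂.card - W.card) := by
      have := Finset.card_le_card hx.1
      have := Finset.card_le_card hx.2
      omega
    simp only [binWeight, Finset.card_union_of_disjoint hd, Finset.card_union_of_disjoint h, e,
      pow_add]
    ring

/-- Harris' inequality for an increasing and a decreasing function. -/
theorem binExp_mul_le [Fintype α] {p : ℝ} (h0 : 0 ≤ p) (h1 : p ≤ 1) {A : Finset α}
    {f g : Finset α → ℝ} (hf0 : ∀ S ⊆ A, 0 ≤ f S)
    (hf : ∀ S S', S ⊆ S' → S' ⊆ A → f S ≤ f S')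
    (hg1 : ∀ S ⊆ A, g S ≤ 1) (hg : ∀ S S', S ⊆ S' → S' ⊆ A → g S' ≤ g S) :
    binExp p A (fun S => f S * g S) ≤ binExp p A f * binExp p A g := by
  -- `fkg` is applied on the whole lattice `Finset α`: the weight is extended by zero and the
  -- functions are composed with `· ∩ A`. The decreasing `g` enters as `1 - g`, which is increasing
  -- and nonnegative.
  set μ : Finset α → ℝ := fun S => if S ⊆ A then binWeight p A S else 0 with hμ
  have key : ∀ F : Finset α → ℝ, ∑ S, μ S * F (S ∩ A) = binExp p A F := fun F => by
    rw [binExp, ← Finset.sum_subset (Finset.subset_univ A.powerset)]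
    · refine Finset.sum_congr rfl fun S hS => ?_
      rw [Finset.mem_powerset] at hS
      simp only [hμ, if_pos hS, Finset.inter_eq_left.2 hS]
    · intro S _ hS
      rw [Finset.mem_powerset] at hS
      -- Outside the powerset the extended weight vanishes.
      simp only [hμ, if_neg hS, zero_mul]
  have hin : ∀ S : Finset α, S ∩ A ⊆ A := fun S => Finset.inter_subset_right
  have h := fkg (μ := μ) (f := fun S => f (S ∩ A)) (g := fun S => 1 - g (S ∩ A))
    (fun S => by
      simp only [hμ, Pi.zero_apply]; split_ifs
      exacts [binWeight_nonneg h0 h1 A S, le_rfl])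
    (fun S => hf0 _ (hin S)) (fun S => sub_nonneg.2 (hg1 _ (hin S)))
    (fun S S' hS => hf _ _ (Finset.inter_subset_inter_right hS) (hin S'))
    (fun S S' hS => sub_le_sub_left (hg _ _ (Finset.inter_subset_inter_right hS) (hin S')) 1)
    (fun S S' => by
      -- The lattice condition is an equality inside the powerset, because cardinality is modular,
      -- and trivial outside it.
      by_cases hS : S ⊆ A
      · by_cases hS' : S' ⊆ A
        · have e1 := Finset.card_union_add_card_inter S S'
          have e2 := Finset.card_le_card (Finset.union_subset hS hS')
          have e3 := Finset.card_le_card (Finset.inter_subset_left (s₁ := S) (s₂ := S'))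
          have e4 := Finset.card_le_card hS
          have e5 := Finset.card_le_card hS'
          simp only [hμ, if_pos hS, if_pos hS', Finset.inf_eq_inter, Finset.sup_eq_union,
            if_pos (Finset.union_subset hS hS'),
            if_pos (Finset.inter_subset_left.trans hS), binWeight]
          apply le_of_eq
          calc p ^ S.card * (1 - p) ^ (A.card - S.card) *
                (p ^ S'.card * (1 - p) ^ (A.card - S'.card))
              = p ^ (S.card + S'.card) *
                (1 - p) ^ ((A.card - S.card) + (A.card - S'.card)) := by ring
            _ = p ^ ((S ∩ S').card + (S ∪ S').card) *
                (1 - p) ^ ((A.card - (S ∩ S').card) + (A.card - (S ∪ S').card)) := by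
                congr 2 <;> omega
            _ = _ := by ring
        · simp only [hμ, if_neg hS', mul_zero]
          refine mul_nonneg ?_ ?_ <;> split_ifs
          all_goals first | exact binWeight_nonneg h0 h1 A _ | exact le_rfl
      · simp only [hμ, if_neg hS, zero_mul]
        refine mul_nonneg ?_ ?_ <;> split_ifs
        all_goals first | exact binWeight_nonneg h0 h1 A _ | exact le_rfl)
  have k1 := key (fun _ => 1)
  have k2 := key f
  have k3 := key (fun S => 1 - g S)
  have k4 := key (fun S => f S * (1 - g S))
  simp only [mul_one] at k1
  rw [k1, k2, k3, k4, binExp_one, binExp_sub, binExp_one] at h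
  have e : binExp p A (fun S => f S * (1 - g S)) =
      binExp p A f - binExp p A (fun S => f S * g S) := by
    rw [← binExp_sub]
    exact binExp_congr fun S _ => by ring
  rw [e] at h
  linarith

end Binomial

/-! ### The random satisfiable process -/

section Outcome

variable {n : ℕ}

theorem Satisfies.mono {ψ : Assignment n} {F G : Formula n} (h : Satisfies ψ G) (hFG : F ⊆ G) :
    Satisfies ψ F := fun C hC => h C (hFG hC)

theorem Satisfies.insert {ψ : Assignment n} {F : Formula n} {C : Clause n} (h : Satisfies ψ F)
    (hC : ∃ l ∈ C, LitTrue ψ l) : Satisfies ψ (insert C F) := by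
  intro C' hC'
  rcases Finset.mem_insert.1 hC' with rfl | h'
  exacts [hC, h C' h']

theorem satStep_subset_insert (S F : Formula n) (C : Clause n) :
    satStep S F C ⊆ insert C F := by
  unfold satStep
  split_ifs
  exacts [Finset.Subset.refl _, Finset.subset_insert _ _]

theorem subset_satStep (S F : Formula n) (C : Clause n) : F ⊆ satStep S F C := by
  unfold satStep
  split_ifs
  exacts [Finset.subset_insert _ _, Finset.Subset.refl _]

theorem subset_foldl_satStep (S : Formula n) (L : List (Clause n)) (F : Formula n) :
    F ⊆ L.foldl (satStep S) F := by
  induction L generalizing F with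
  | nil => exact Finset.Subset.refl _
  | cons C L ih => exact (subset_satStep S F C).trans (ih _)

theorem foldl_satStep_subset (S : Formula n) (L : List (Clause n)) {F : Formula n} (hF : F ⊆ S) :
    L.foldl (satStep S) F ⊆ S := by
  induction L generalizing F with
  | nil => exact hF
  | cons C L ih =>
    refine ih ?_
    unfold satStep
    split_ifs with h
    exacts [Finset.insert_subset h.1 hF, hF]

theorem satisfiable_foldl_satStep (S : Formula n) (L : List (Clause n)) {F : Formula n}
    (hF : Satisfiable F) : Satisfiable (L.foldl (satStep S) F) := by
  induction L generalizing F with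
  | nil => exact hF
  | cons C L ih =>
    refine ih ?_
    unfold satStep
    split_ifs with h
    exacts [h.2, hF]

/-- A satisfying assignment of the outcome admits every successful clause that it satisfies. -/
theorem mem_foldl_satStep {S : Formula n} {L : List (Clause n)} {F : Formula n}
    {ψ : Assignment n} (h : Satisfies ψ (L.foldl (satStep S) F)) {C : Clause n} (hCS : C ∈ S)
    (hCL : C ∈ L) (hC : ∃ l ∈ C, LitTrue ψ l) : C ∈ L.foldl (satStep S) F := by
  induction L generalizing F with
  | nil => simp at hCL
  | cons C' L ih =>
    rw [List.foldl_cons] at h ⊢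
    rcases List.mem_cons.1 hCL with rfl | h'
    · refine subset_foldl_satStep S L _ ?_
      have hF : Satisfies ψ F :=
        h.mono ((subset_satStep S F C).trans (subset_foldl_satStep S L _))
      unfold satStep
      rw [if_pos ⟨hCS, ψ, hF.insert hC⟩]
      exact Finset.mem_insert_self _ _
    · exact ih h h'

/-- The event that `ψ` satisfies the outcome is increasing in the clauses satisfied by `ψ` and
decreasing in the other ones. -/
theorem satisfies_foldl_satStep_mono {S S' : Formula n} {ψ : Assignment n} (hS : S ⊆ S')
    (hS' : ∀ C ∈ S', (¬ ∃ l ∈ C, LitTrue ψ l) → C ∈ S) (L : List (Clause n)) {F F' : Formula n}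
    (hF : F ⊆ F') (hF' : Satisfies ψ F') (h : Satisfies ψ (L.foldl (satStep S) F)) :
    Satisfies ψ (L.foldl (satStep S') F') := by
  induction L generalizing F F' with
  | nil => exact hF'
  | cons C L ih =>
    rw [List.foldl_cons] at h ⊢
    have h1 : Satisfies ψ (satStep S F C) := h.mono (subset_foldl_satStep S L _)
    by_cases hC : ∃ l ∈ C, LitTrue ψ l
    · by_cases hCS : C ∈ S'
      · have e : satStep S' F' C = insert C F' := by
          unfold satStep
          rw [if_pos ⟨hCS, ψ, hF'.insert hC⟩]
        refine ih ?_ ?_ h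
        · rw [e]
          exact (satStep_subset_insert S F C).trans (Finset.insert_subset_insert C hF)
        · rw [e]
          exact hF'.insert hC
      · have e : satStep S' F' C = F' := by
          unfold satStep
          rw [if_neg fun hh => hCS hh.1]
        have e' : satStep S F C = F := by
          unfold satStep
          rw [if_neg fun hh => hCS (hS hh.1)]
        refine ih ?_ ?_ h
        · rwa [e, e']
        · rwa [e]
    -- `C` is false under `ψ`, yet `ψ` satisfies the final outcome, so `C` was not accepted. With
    -- the larger current formula `F'` it is rejected all the more.
    · have hn : ¬ (C ∈ S ∧ Satisfiable (insert C F)) := by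
        intro hh
        unfold satStep at h1
        rw [if_pos hh] at h1
        exact hC (h1 C (Finset.mem_insert_self _ _))
      have hn' : ¬ (C ∈ S' ∧ Satisfiable (insert C F')) := by
        rintro ⟨hCS, φ, hφ⟩
        exact hn ⟨hS' C hCS hC, φ, hφ.mono (Finset.insert_subset_insert C hF)⟩
      have e : satStep S' F' C = F' := by
        unfold satStep
        rw [if_neg hn']
      have e' : satStep S F C = F := by
        unfold satStep
        rw [if_neg hn]
      refine ih ?_ ?_ h
      · rwa [e, e']
      · rwa [e]

theorem satFormula_subset (σ : ClauseOrder n) (S : Formula n) : satFormula σ S ⊆ S :=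
  foldl_satStep_subset S _ (Finset.empty_subset S)

theorem satisfiable_satFormula (σ : ClauseOrder n) (S : Formula n) :
    Satisfiable (satFormula σ S) :=
  satisfiable_foldl_satStep S _ ⟨fun _ => true, fun _ h => absurd h (Finset.notMem_empty _)⟩

theorem mem_satFormula {σ : ClauseOrder n} {S : Formula n} {ψ : Assignment n}
    (h : Satisfies ψ (satFormula σ S)) {C : Clause n} (hCS : C ∈ S) (hC : C ∈ allClauses n)
    (hψ : ∃ l ∈ C, LitTrue ψ l) : C ∈ satFormula σ S := by
  refine mem_foldl_satStep h hCS ?_ hψ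
  rw [List.mem_ofFn]
  exact ⟨σ.symm ⟨C, hC⟩, by simp⟩

theorem satisfies_satFormula_mono {σ : ClauseOrder n} {S S' : Formula n} {ψ : Assignment n}
    (hS : S ⊆ S') (hS' : ∀ C ∈ S', (¬ ∃ l ∈ C, LitTrue ψ l) → C ∈ S)
    (h : Satisfies ψ (satFormula σ S)) : Satisfies ψ (satFormula σ S') :=
  satisfies_foldl_satStep_mono hS hS' _ (Finset.Subset.refl _)
    (fun _ h => absurd h (Finset.notMem_empty _)) h

open Classical in
/-- The clauses satisfied by `ψ`. -/
noncomputable def trueClauses (ψ : Assignment n) : Formula n :=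
  (allClauses n).filter fun C => ∃ l ∈ C, LitTrue ψ l

theorem mem_trueClauses {ψ : Assignment n} {C : Clause n} :
    C ∈ trueClauses ψ ↔ C ∈ allClauses n ∧ ∃ l ∈ C, LitTrue ψ l := by
  classical
  simp [trueClauses]

/-- If `ψ` satisfies the outcome, then the outcome consists of all successful clauses satisfied
by `ψ`. -/
theorem satFormula_eq_inter {σ : ClauseOrder n} {S : Formula n} (hS : S ⊆ allClauses n)
    {ψ : Assignment n} (h : Satisfies ψ (satFormula σ S)) :
    satFormula σ S = S ∩ trueClauses ψ := by
  ext C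
  rw [Finset.mem_inter, mem_trueClauses]
  exact ⟨fun hC => ⟨satFormula_subset σ S hC, hS (satFormula_subset σ S hC), h C hC⟩,
    fun hC => mem_satFormula h hC.1 hC.2.1 hC.2.2⟩

open Classical in
/-- The satisfying assignments of `F`. -/
noncomputable def solutions (F : Formula n) : Finset (Assignment n) :=
  Finset.univ.filter fun ψ => Satisfies ψ F

theorem mem_solutions {F : Formula n} {ψ : Assignment n} : ψ ∈ solutions F ↔ Satisfies ψ F := by
  classical
  simp [solutions]

open Classical in
/-- The probability that a uniformly random satisfying assignment of `F` equals `ψ`. -/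
noncomputable def solutionWeight (ψ : Assignment n) (F : Formula n) : ℝ :=
  if Satisfies ψ F then ((solutions F).card : ℝ)⁻¹ else 0

theorem solutionWeight_nonneg (ψ : Assignment n) (F : Formula n) : 0 ≤ solutionWeight ψ F := by
  unfold solutionWeight
  split_ifs
  exacts [by positivity, le_rfl]

theorem sum_solutionWeight {F : Formula n} (hF : Satisfiable F) :
    ∑ ψ, solutionWeight ψ F = 1 := by
  classical
  unfold solutionWeight
  rw [← Finset.sum_filter, Finset.sum_const, nsmul_eq_mul]
  obtain ⟨ψ, hψ⟩ := hF
  have : (solutions F).card ≠ 0 := Finset.card_ne_zero_of_mem (mem_solutions.2 hψ)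
  exact mul_inv_cancel₀ (Nat.cast_ne_zero.2 this)

/-- Adding successful clauses true under `ψ` keeps `ψ` a solution and enlarges the outcome, so the
number of solutions can only drop. This is the monotonicity that Harris' inequality needs. -/
theorem solutionWeight_satFormula_mono {σ : ClauseOrder n} {ψ : Assignment n}
    {S S' : Formula n} (hS : S ⊆ S') (hA : S' ⊆ allClauses n)
    (hS' : ∀ C ∈ S', (¬ ∃ l ∈ C, LitTrue ψ l) → C ∈ S) :
    solutionWeight ψ (satFormula σ S) ≤ solutionWeight ψ (satFormula σ S') := by
  by_cases h : Satisfies ψ (satFormula σ S)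
  · have h' : Satisfies ψ (satFormula σ S') := satisfies_satFormula_mono hS hS' h
    unfold solutionWeight
    rw [if_pos h, if_pos h']
    have hc : 0 < (solutions (satFormula σ S')).card :=
      Finset.card_pos.2 ⟨ψ, mem_solutions.2 h'⟩
    refine inv_anti₀ (by exact_mod_cast hc) ?_
    norm_cast
    refine Finset.card_le_card fun φ hφ => mem_solutions.2 ((mem_solutions.1 hφ).mono ?_)
    rw [satFormula_eq_inter hA h', satFormula_eq_inter (hS.trans hA) h]
    exact Finset.inter_subset_inter_right hS
  · have e : solutionWeight ψ (satFormula σ S) = 0 := if_neg h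
    rw [e]
    exact solutionWeight_nonneg _ _

/-- The decorrelation inequality: the tilted law of the outcome and a random solution `ψ` is
dominated by the planted law as far as decreasing functions are concerned, and by the law of the
successful clauses as far as the presence of `T` is concerned. -/
theorem sum_binExp_solutionWeight_le (σ : ClauseOrder n) {p y : ℝ} (h0 : 0 ≤ p) (h1 : p ≤ 1)
    (hy0 : 0 ≤ y) (hy1 : y ≤ 1) {T : Formula n} (hT : T ⊆ allClauses n)
    (Q : Assignment n → Formula n) (hQ : ∀ ψ, Q ψ ⊆ trueClauses ψ) {N : ℕ}
    (hN : ∀ ψ, N ≤ (Q ψ).card) :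
    ∑ ψ, binExp p (allClauses n) (fun S => solutionWeight ψ (satFormula σ S) *
      (if T ⊆ satFormula σ S then 1 else 0) * y ^ (satFormula σ S ∩ Q ψ).card) ≤
      p ^ T.card * (1 - p + p * y) ^ N := by
  classical
  have step : ∀ ψ, binExp p (allClauses n) (fun S => solutionWeight ψ (satFormula σ S) *
      (if T ⊆ satFormula σ S then 1 else 0) * y ^ (satFormula σ S ∩ Q ψ).card) ≤
      binExp p (allClauses n) (fun S => solutionWeight ψ (satFormula σ S) *
      (if T ⊆ satFormula σ S then 1 else 0)) * (1 - p + p * y) ^ N := by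
    intro ψ
    set A₁ := trueClauses ψ with hA₁
    set A₂ := allClauses n \ A₁ with hA₂
    have hA₁s : A₁ ⊆ allClauses n := Finset.filter_subset _ _
    have hA : allClauses n = A₁ ∪ A₂ := (Finset.union_sdiff_of_subset hA₁s).symm
    have hd : Disjoint A₁ A₂ := Finset.disjoint_sdiff
    have hN' : binExp p A₁ (fun G => y ^ (G ∩ Q ψ).card) ≤ (1 - p + p * y) ^ N := by
      rw [binExp_pow_card_inter, Finset.inter_eq_right.2 (hQ ψ)]
      exact pow_le_pow_of_le_one (by nlinarith) (by nlinarith) (hN ψ)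
    -- Condition on `W`, the successful clauses false under `ψ`; only the true ones `G` remain
    -- random.
    rw [hA, binExp_union p hd, binExp_union p hd, ← binExp_mul_const]
    refine binExp_mono h0 h1 fun W hW => ?_
    have hsub : ∀ G ⊆ A₁, G ∪ W ⊆ allClauses n := fun G hG => by
      rw [hA]; exact Finset.union_subset_union hG hW
    have hWt : ∀ G ⊆ A₁, (G ∪ W) ∩ A₁ = G := fun G hG => by
      rw [Finset.union_inter_distrib_right, Finset.inter_eq_left.2 hG,
        Finset.disjoint_iff_inter_eq_empty.1 (hd.symm.mono_left hW), Finset.union_empty]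
    have hform : ∀ G ⊆ A₁, Satisfies ψ (satFormula σ (G ∪ W)) → satFormula σ (G ∪ W) = G :=
      fun G hG h => by rw [satFormula_eq_inter (hsub G hG) h, hWt G hG]
    have hmono : ∀ G G', G ⊆ G' → G' ⊆ A₁ →
        solutionWeight ψ (satFormula σ (G ∪ W)) ≤ solutionWeight ψ (satFormula σ (G' ∪ W)) := by
      intro G G' hGG' hG'
      refine solutionWeight_satFormula_mono (Finset.union_subset_union_left hGG') (hsub G' hG') ?_
      intro C hC hCψ
      rcases Finset.mem_union.1 hC with h | h
      · exact absurd (mem_trueClauses.1 (hG' h)).2 hCψ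
      · exact Finset.mem_union_right _ h
    -- Where the weight is nonzero the outcome equals `G`, and elsewhere both sides vanish. The
    -- remaining factors thus become explicitly monotone in `G`.
    have e1 : binExp p A₁ (fun G => solutionWeight ψ (satFormula σ (G ∪ W)) *
        (if T ⊆ satFormula σ (G ∪ W) then 1 else 0) * y ^ (satFormula σ (G ∪ W) ∩ Q ψ).card) =
        binExp p A₁ (fun G => (solutionWeight ψ (satFormula σ (G ∪ W)) *
          (if T ⊆ G then 1 else 0)) * y ^ (G ∩ Q ψ).card) := by
      refine binExp_congr fun G hG => ?_
      by_cases h : Satisfies ψ (satFormula σ (G ∪ W))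
      · rw [hform G hG h]
      · rw [solutionWeight, if_neg h]; simp
    have e2 : binExp p A₁ (fun G => solutionWeight ψ (satFormula σ (G ∪ W)) *
        (if T ⊆ satFormula σ (G ∪ W) then 1 else 0)) =
        binExp p A₁ (fun G => solutionWeight ψ (satFormula σ (G ∪ W)) *
          (if T ⊆ G then 1 else 0)) := by
      refine binExp_congr fun G hG => ?_
      by_cases h : Satisfies ψ (satFormula σ (G ∪ W))
      · rw [hform G hG h]
      · rw [solutionWeight, if_neg h]; simp
    have hnn : ∀ G ⊆ A₁, 0 ≤ solutionWeight ψ (satFormula σ (G ∪ W)) *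
        (if T ⊆ G then (1 : ℝ) else 0) := fun G _ =>
      mul_nonneg (solutionWeight_nonneg _ _) (by split_ifs <;> norm_num)
    rw [e1, e2]
    refine (binExp_mul_le h0 h1 hnn ?_ ?_ ?_).trans
      (mul_le_mul_of_nonneg_left hN' (binExp_nonneg h0 h1 hnn))
    · intro G G' hGG' hG'
      refine mul_le_mul (hmono G G' hGG' hG') ?_ (by split_ifs <;> norm_num)
        (solutionWeight_nonneg _ _)
      split_ifs with ha hb
      exacts [le_rfl, absurd (ha.trans hGG') hb, zero_le_one, le_rfl]
    · intro G _
      exact pow_le_one₀ hy0 hy1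
    · intro G G' hGG' _
      exact pow_le_pow_of_le_one hy0 hy1
        (Finset.card_le_card (Finset.inter_subset_inter_right hGG'))
  refine (Finset.sum_le_sum fun ψ _ => step ψ).trans ?_
  rw [← Finset.sum_mul]
  refine mul_le_mul_of_nonneg_right ?_ (pow_nonneg (by nlinarith) _)
  -- Summed over `ψ` the weights give 1, and `T` can lie in the outcome only if all its tosses
  -- succeed.
  rw [← binExp_sum, ← binExp_subset p hT]
  refine binExp_mono h0 h1 fun S _ => ?_
  rw [← Finset.sum_mul, sum_solutionWeight (satisfiable_satFormula σ S), one_mul]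
  split_ifs with ha hb
  exacts [le_rfl, absurd (ha.trans (satFormula_subset σ S)) hb, zero_le_one, le_rfl]

end Outcome

/-! ### Counting connected sets -/

section ConnectedSets

variable {V : Type*} [DecidableEq V]

/-- The vertex sets of the trees with `m` edges that contain `u`, enumerated through the
left-child right-sibling recursion. -/
def treeSets (nbrs : V → Finset V) : ℕ → V → Finset (Finset V)
  | 0, u => {{u}}
  | m + 1, u => Finset.univ.biUnion fun i : Fin (m + 1) => (nbrs u).biUnion fun w =>
      Finset.image₂ (· ∪ ·) (treeSets nbrs i w) (treeSets nbrs (m - i) u)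
termination_by m => m
decreasing_by all_goals omega

theorem mem_treeSets_succ {nbrs : V → Finset V} {m : ℕ} {u : V} {T : Finset V} :
    T ∈ treeSets nbrs (m + 1) u ↔ ∃ i j, i + j = m ∧ ∃ w ∈ nbrs u,
      ∃ A ∈ treeSets nbrs i w, ∃ B ∈ treeSets nbrs j u, A ∪ B = T := by
  rw [treeSets]
  simp only [Finset.mem_biUnion, Finset.mem_univ, true_and, Finset.mem_image₂]
  constructor
  · rintro ⟨i, w, hw, A, hA, B, hB, h⟩
    exact ⟨i, m - i, by omega, w, hw, A, hA, B, hB, h⟩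
  · rintro ⟨i, j, hij, w, hw, A, hA, B, hB, h⟩
    refine ⟨⟨i, by omega⟩, w, hw, A, hA, B, ?_, h⟩
    rwa [show m - (⟨i, by omega⟩ : Fin (m + 1)).1 = j by simp; omega]

/-- A new leaf at `v` is attached within whichever of the two subtrees contains `v`. Consequently
every set grown from `u` by successive neighbours is enumerated. -/
theorem insert_mem_treeSets {nbrs : V → Finset V} {m : ℕ} {u v w : V} {T : Finset V}
    (hT : T ∈ treeSets nbrs m u) (hv : v ∈ T) (hw : w ∈ nbrs v) :
    insert w T ∈ treeSets nbrs (m + 1) u := by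
  induction m using Nat.strong_induction_on generalizing u T with
  | _ m ih =>
    match m with
    | 0 =>
      rw [treeSets, Finset.mem_singleton] at hT
      subst hT
      rw [Finset.mem_singleton] at hv
      subst hv
      refine mem_treeSets_succ.2 ⟨0, 0, rfl, w, hw, {w}, ?_, {v}, ?_, rfl⟩ <;>
        rw [treeSets, Finset.mem_singleton]
    | m + 1 =>
      obtain ⟨i, j, hij, w', hw', A, hA, B, hB, rfl⟩ := mem_treeSets_succ.1 hT
      rcases Finset.mem_union.1 hv with h | h
      · exact mem_treeSets_succ.2 ⟨i + 1, j, by omega, w', hw', insert w A,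
          ih i (by omega) hA h, B, hB, Finset.insert_union w A B⟩
      · exact mem_treeSets_succ.2 ⟨i, j + 1, by omega, w', hw', A, hA, insert w B,
          ih j (by omega) hB h, Finset.union_insert w A B⟩

/-- The recursion splits off the first child's subtree, exactly as in the Catalan recurrence, with a
factor `Δ` for the choice of each child. -/
theorem card_treeSets_le_catalan {nbrs : V → Finset V} {Δ : ℕ} (h : ∀ v, (nbrs v).card ≤ Δ)
    (m : ℕ) (u : V) : (treeSets nbrs m u).card ≤ catalan m * Δ ^ m := by
  induction m using Nat.strong_induction_on generalizing u with
  | _ m ih =>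
    match m with
    | 0 => simp [treeSets]
    | m + 1 =>
      rw [treeSets, catalan_succ, Finset.sum_mul]
      refine Finset.card_biUnion_le.trans (Finset.sum_le_sum fun i _ => ?_)
      have hi : (i : ℕ) ≤ m := by omega
      calc _ ≤ ∑ w ∈ nbrs u, catalan i * Δ ^ (i : ℕ) * (catalan (m - i) * Δ ^ (m - i)) := by
            refine Finset.card_biUnion_le.trans (Finset.sum_le_sum fun w _ => ?_)
            exact (Finset.card_image₂_le _ _ _).trans
              (Nat.mul_le_mul (ih i (by omega) w) (ih (m - i) (by omega) u))
        _ ≤ Δ * (catalan i * Δ ^ (i : ℕ) * (catalan (m - i) * Δ ^ (m - i))) := by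
            rw [Finset.sum_const, smul_eq_mul]
            exact Nat.mul_le_mul_right _ (h u)
        _ = catalan i * catalan (m - i) * (Δ ^ ((i : ℕ) + (m - i)) * Δ) := by ring
        _ = _ := by rw [show (i : ℕ) + (m - i) = m by omega, pow_succ]

theorem catalan_le_four_pow (m : ℕ) : catalan m ≤ 4 ^ m := by
  rw [catalan_eq_centralBinom_div]
  exact (Nat.div_le_self _ _).trans (Nat.centralBinom_le_four_pow m)

theorem card_treeSets_le {nbrs : V → Finset V} {Δ : ℕ} (h : ∀ v, (nbrs v).card ≤ Δ)
    (m : ℕ) (u : V) : (treeSets nbrs m u).card ≤ (4 * Δ) ^ m := by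
  rw [mul_pow]
  exact (card_treeSets_le_catalan h m u).trans
    (Nat.mul_le_mul_right _ (catalan_le_four_pow m))

end ConnectedSets

/-! ### Counting clauses and their neighbours -/

section Clauses

variable {n : ℕ}

theorem card_vars {C : Clause n} (h : C ∈ allClauses n) : C.vars.card = 3 :=
  (Finset.mem_filter.1 h).2

theorem card_clause {C : Clause n} (h : C ∈ allClauses n) : C.card = 3 :=
  (Finset.mem_powersetCard.1 (Finset.mem_filter.1 h).1).2

theorem mem_vars {C : Clause n} {x : Fin n} : x ∈ C.vars ↔ ∃ l ∈ C, l.1 = x := by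
  simp [Clause.vars]

theorem injOn_fst_clause {C : Clause n} (h : C ∈ allClauses n) :
    Set.InjOn Prod.fst (C : Set (Literal n)) := by
  rw [← Finset.card_image_iff]
  exact (card_vars h).trans (card_clause h).symm

/-- The clauses that contain the variable `x`. -/
def clausesAt (x : Fin n) : Formula n := (allClauses n).filter fun C => x ∈ C.vars

theorem card_clausesAt_le (x : Fin n) : (clausesAt x).card ≤ 8 * n ^ 2 := by
  have hsub : clausesAt x ⊆ (Finset.univ : Finset (Bool × Literal n × Literal n)).image
      fun a => {(x, a.1), a.2.1, a.2.2} := by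
    intro C hC
    obtain ⟨hCA, hx⟩ := Finset.mem_filter.1 hC
    obtain ⟨⟨x', b⟩, hl, rfl⟩ := mem_vars.1 hx
    have h2 : (C.erase (x', b)).card = 2 := by rw [Finset.card_erase_of_mem hl, card_clause hCA]
    obtain ⟨l₁, l₂, -, h12⟩ := Finset.card_eq_two.1 h2
    refine Finset.mem_image.2 ⟨(b, l₁, l₂), Finset.mem_univ _, ?_⟩
    simp only
    rw [← h12, Finset.insert_erase hl]
  refine (Finset.card_le_card hsub).trans (Finset.card_image_le.trans (le_of_eq ?_))
  simp only [Finset.card_univ, Fintype.card_prod, Fintype.card_bool, Fintype.card_fin]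
  ring

theorem card_allClauses_le (n : ℕ) : (allClauses n).card ≤ 8 * n ^ 3 := by
  have hsub : allClauses n ⊆ Finset.univ.biUnion (clausesAt (n := n)) := by
    intro C hC
    have : C.vars.Nonempty := by
      rw [← Finset.card_pos, card_vars hC]; norm_num
    obtain ⟨x, hx⟩ := this
    exact Finset.mem_biUnion.2 ⟨x, Finset.mem_univ _, Finset.mem_filter.2 ⟨hC, hx⟩⟩
  refine (Finset.card_le_card hsub).trans (Finset.card_biUnion_le.trans ?_)
  refine (Finset.sum_le_sum fun x _ => card_clausesAt_le x).trans (le_of_eq ?_)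
  simp only [Finset.sum_const, Finset.card_univ, Fintype.card_fin, smul_eq_mul]
  ring

/-- The clauses that share a variable with `C`. -/
def clauseNbrs (C : Clause n) : Formula n :=
  if C ∈ allClauses n then C.vars.biUnion clausesAt else ∅

theorem card_clauseNbrs_le (C : Clause n) : (clauseNbrs C).card ≤ 24 * n ^ 2 := by
  unfold clauseNbrs
  split_ifs with h
  · refine (Finset.card_biUnion_le.trans (Finset.sum_le_sum fun x _ => card_clausesAt_le x)).trans
      (le_of_eq ?_)
    rw [Finset.sum_const, card_vars h, smul_eq_mul]
    ring
  · simp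

/-- The variables that appear in the clauses of `T`. -/
def Formula.vars (T : Formula n) : Finset (Fin n) := T.biUnion Clause.vars

theorem card_formula_vars_le {T : Formula n} (hT : T ⊆ allClauses n) :
    T.vars.card ≤ 3 * T.card := by
  refine Finset.card_biUnion_le.trans (le_of_eq ?_)
  rw [Finset.sum_congr rfl fun C hC => card_vars (hT hC), Finset.sum_const, smul_eq_mul, mul_comm]

end Clauses

/-! ### Peeling, cores and frozen variables -/

section Core

variable {n : ℕ}

theorem Supports.mem_vars {ψ : Assignment n} {x : Fin n} {C : Clause n} (h : Supports ψ x C) :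
    x ∈ C.vars := by
  obtain ⟨l, hl, hx, -⟩ := h
  exact RandomSat.mem_vars.2 ⟨l, hl, hx⟩

theorem Supports.unique {ψ : Assignment n} {x y : Fin n} {C : Clause n} (h : Supports ψ x C)
    (h' : Supports ψ y C) : x = y := by
  obtain ⟨l, hl, hx, ht, hu⟩ := h
  obtain ⟨l', hl', hx', ht', hu'⟩ := h'
  rw [← hx, ← hx', hu l' hl' ht']

open Classical in
/-- The clauses of `F` supported by `x`. -/
noncomputable def supported (F : Formula n) (ψ : Assignment n) (x : Fin n) : Formula n :=
  F.filter fun C => Supports ψ x C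

open Classical in
/-- The variables that support fewer than `r` clauses of `F`. -/
noncomputable def lowSupport (F : Formula n) (ψ : Assignment n) (r : ℕ) : Finset (Fin n) :=
  Finset.univ.filter fun x => (supported F ψ x).card < r

/-- The clauses of `F` that contain `x` and a variable of `U`. -/
def touching (F : Formula n) (U : Finset (Fin n)) (x : Fin n) : Formula n :=
  F.filter fun C => x ∈ C.vars ∧ (C.vars ∩ U).Nonempty

/-- The sets obtained from `B` by successively adding variables that share more than `t / 3`
clauses with the current set. -/
inductive Peels (F : Formula n) (t : ℕ) (B : Finset (Fin n)) : Finset (Fin n) → Prop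
  | base : Peels F t B B
  | step (U : Finset (Fin n)) (x : Fin n) (hU : Peels F t B U) (hx : x ∉ U)
      (h : t < 3 * (touching F U x).card) : Peels F t B (insert x U)

theorem Peels.subset {F : Formula n} {t : ℕ} {B U : Finset (Fin n)} (h : Peels F t B U) :
    B ⊆ U := by
  induction h with
  | base => exact Finset.Subset.refl _
  | step U x _ _ _ ih => exact ih.trans (Finset.subset_insert _ _)

theorem exists_peels_maximal (F : Formula n) (t : ℕ) (B : Finset (Fin n)) :
    ∃ U, Peels F t B U ∧ ∀ x ∉ U, 3 * (touching F U x).card ≤ t := by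
  classical
  obtain ⟨U, hU, hmax⟩ := Finset.exists_max_image
    (Finset.univ.filter fun U : Finset (Fin n) => Peels F t B U) Finset.card
    ⟨B, by simp [Peels.base]⟩
  simp only [Finset.mem_filter, Finset.mem_univ, true_and] at hU hmax
  refine ⟨U, hU, fun x hx => ?_⟩
  by_contra h
  have := hmax _ (Peels.step U x hU hx (not_le.1 h))
  rw [Finset.card_insert_of_notMem hx] at this
  omega

/-- A variable outside `B` supports at least 2t clauses and loses at most t/3 of them to clauses
meeting `B`. This slack is why low support is measured against 2t. -/
theorem isCore_compl {F : Formula n} {ψ : Assignment n} {t : ℕ} {B : Finset (Fin n)}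
    (hB : lowSupport F ψ (2 * t) ⊆ B) (h : ∀ x ∉ B, 3 * (touching F B x).card ≤ t) :
    IsCore F ψ t Bᶜ := by
  classical
  have hsub : ∀ x, (F \ F.restrict Bᶜ).filter (fun C => x ∈ C.vars) ⊆ touching F B x := by
    intro x C hC
    simp only [Finset.mem_filter, Finset.mem_sdiff, Formula.restrict, not_and] at hC
    obtain ⟨⟨hCF, hCB⟩, hx⟩ := hC
    obtain ⟨y, hy, hyB⟩ := Finset.not_subset.1 (hCB hCF)
    rw [Finset.mem_compl, not_not] at hyB
    exact Finset.mem_filter.2 ⟨hCF, hx, y, Finset.mem_inter.2 ⟨hy, hyB⟩⟩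
  constructor
  · intro x hx
    rw [Finset.mem_compl] at hx
    have h1 : 2 * t ≤ (supported F ψ x).card := by
      by_contra hlt
      exact hx (hB (by simp only [lowSupport, Finset.mem_filter, Finset.mem_univ, true_and]; omega))
    have h2 : supported F ψ x ⊆
        ((F.restrict Bᶜ).filter fun C => Supports ψ x C) ∪ touching F B x := by
      intro C hC
      obtain ⟨hCF, hs⟩ := Finset.mem_filter.1 hC
      by_cases hCB : C ∈ F.restrict Bᶜ
      · exact Finset.mem_union_left _ (Finset.mem_filter.2 ⟨hCB, hs⟩)
      · exact Finset.mem_union_right _ (hsub x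
          (Finset.mem_filter.2 ⟨Finset.mem_sdiff.2 ⟨hCF, hCB⟩, hs.mem_vars⟩))
    have h3 := (Finset.card_le_card h2).trans (Finset.card_union_le _ _)
    have h4 := h x hx
    have h5 : ((F.restrict Bᶜ).filter fun C => Supports ψ x C).card =
      (@Finset.filter _ (fun C => Supports ψ x C) (fun a => Classical.propDecidable _)
        (F.restrict Bᶜ)).card := by congr
    omega
  · intro x hx
    rw [Finset.mem_compl] at hx
    have h1 := Finset.card_le_card (hsub x)
    have h2 := h x hx
    have h3 : (3 * ((F \ F.restrict Bᶜ).filter (fun C => x ∈ C.vars)).card : ℝ) ≤ t := by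
      exact_mod_cast (by omega)
    linarith

/-- The excess of the incidences between `U` and the clauses of `F`. -/
def excess (F : Formula n) (U : Finset (Fin n)) : ℕ := ∑ C ∈ F, ((C.vars ∩ U).card - 1)

theorem excess_insert (F : Formula n) {U : Finset (Fin n)} {x : Fin n} (hx : x ∉ U) :
    excess F U + (touching F U x).card ≤ excess F (insert x U) := by
  rw [touching, Finset.card_filter, excess, excess, ← Finset.sum_add_distrib]
  refine Finset.sum_le_sum fun C _ => ?_
  split_ifs with h
  · have := h.2.card_pos
    rw [Finset.inter_insert_of_mem h.1, Finset.card_insert_of_notMem (by simp [hx])]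
    omega
  · have := Finset.card_le_card
      (Finset.inter_subset_inter (Finset.Subset.refl C.vars) (Finset.subset_insert x U))
    omega

/-- A 3-clause contributes at most 2, and only if it has two variables in `U`; this links the excess
to proportionality. -/
theorem excess_le {F : Formula n} (hF : F ⊆ allClauses n) (U : Finset (Fin n)) :
    excess F U ≤ 2 * (F.filter fun C => 2 ≤ (C.vars ∩ U).card).card := by
  rw [excess, Finset.card_filter, Finset.mul_sum]
  refine Finset.sum_le_sum fun C hC => ?_
  have h1 := card_vars (hF hC)
  have h2 := Finset.card_le_card (Finset.inter_subset_left (s₁ := C.vars) (s₂ := U))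
  split_ifs with h <;> omega

/-- Each peeled variable raises the excess by more than t/3. Since `K` is closed under adjacency
within `U`, variables of `K` collect all of this inside `U ∩ K`, so the count can be made one
component at a time. -/
theorem Peels.mul_card_le_excess {F : Formula n} {t : ℕ} {B U K : Finset (Fin n)}
    (h : Peels F t B U)
    (hK : ∀ x ∈ K, ∀ y ∈ U, x ∈ U → ∀ C ∈ F, x ∈ C.vars → y ∈ C.vars → y ∈ K) :
    t * ((U ∩ K) \ B).card ≤ 3 * excess F (U ∩ K) := by
  induction h with
  | base =>
    have : (B ∩ K) \ B = ∅ := Finset.sdiff_eq_empty_iff_subset.2 Finset.inter_subset_left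
    simp [this]
  | step U x hU hx ht ih =>
    have ih' := ih fun x hx y hy hxU C hC hxC hyC =>
      hK x hx y (Finset.mem_insert_of_mem hy) (Finset.mem_insert_of_mem hxU) C hC hxC hyC
    by_cases hxK : x ∈ K
    · rw [Finset.insert_inter_of_mem hxK]
      have e := excess_insert F (U := U ∩ K) (x := x) (by simp [hx])
      have e2 : touching F U x ⊆ touching F (U ∩ K) x := by
        intro C hC
        obtain ⟨hCF, hxC, y, hy⟩ := Finset.mem_filter.1 hC
        obtain ⟨hyC, hyU⟩ := Finset.mem_inter.1 hy
        have hyK := hK x hxK y (Finset.mem_insert_of_mem hyU) (Finset.mem_insert_self _ _) C hCF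
          hxC hyC
        exact Finset.mem_filter.2 ⟨hCF, hxC, y,
          Finset.mem_inter.2 ⟨hyC, Finset.mem_inter.2 ⟨hyU, hyK⟩⟩⟩
      have e3 := Finset.card_le_card e2
      have e4 : (insert x (U ∩ K) \ B).card ≤ ((U ∩ K) \ B).card + 1 :=
        (Finset.card_le_card (by
          intro z hz
          simp only [Finset.mem_sdiff, Finset.mem_insert] at hz ⊢
          tauto)).trans (Finset.card_insert_le x _)
      calc t * (insert x (U ∩ K) \ B).card ≤ t * (((U ∩ K) \ B).card + 1) :=
            Nat.mul_le_mul_left _ e4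
        _ = t * ((U ∩ K) \ B).card + t := by ring
        _ ≤ 3 * excess F (insert x (U ∩ K)) := by omega
    · rw [Finset.insert_inter_of_notMem hxK]
      exact ih'

/-- The peeled part costs an excess of t/3 per variable, while proportionality keeps the excess
below 2 · (t/10)|U ∩ K|. Hence at most 3/5 of `U ∩ K` was peeled. -/
theorem Peels.two_mul_card_le {F : Formula n} (hF : F ⊆ allClauses n) {t : ℕ} (ht : 0 < t)
    (hprop : IsProportional F ((t : ℝ) / 10)) {B U K : Finset (Fin n)} (h : Peels F t B U)
    (hK : ∀ x ∈ K, ∀ y ∈ U, x ∈ U → ∀ C ∈ F, x ∈ C.vars → y ∈ C.vars → y ∈ K)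
    (hcard : ((U ∩ K).card : ℝ) ≤ (n : ℝ) / 10 ^ 6) :
    2 * (U ∩ K).card ≤ 5 * (U ∩ K ∩ B).card := by
  rcases (U ∩ K).eq_empty_or_nonempty with h0 | hne
  · simp [h0]
  have h1 := h.mul_card_le_excess hK
  have h2 := excess_le hF (U ∩ K)
  have h3 : ((F.filter fun C => 2 ≤ (C.vars ∩ (U ∩ K)).card).card : ℝ) <
      (t : ℝ) / 10 * ((U ∩ K).card : ℝ) := by
    by_contra hlt
    exact hprop ⟨U ∩ K, hne, hcard, not_lt.1 hlt⟩
  have h4 : 10 * (F.filter fun C => 2 ≤ (C.vars ∩ (U ∩ K)).card).card < t * (U ∩ K).card := by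
    have : (10 * (F.filter fun C => 2 ≤ (C.vars ∩ (U ∩ K)).card).card : ℝ) <
      t * (U ∩ K).card := by linarith
    exact_mod_cast this
  have h5 := Finset.card_sdiff_add_card_inter (U ∩ K) B
  have h6 : t * (10 * ((U ∩ K) \ B).card) ≤ t * (6 * (U ∩ K).card) := by
    calc t * (10 * ((U ∩ K) \ B).card) = 10 * (t * ((U ∩ K) \ B).card) := by ring
      _ ≤ 6 * (t * (U ∩ K).card) := by omega
      _ = _ := by ring
  have h7 := Nat.le_of_mul_le_mul_left h6 ht
  omega

/-- Peeling never outgrows the range of proportionality: the `+ 1` leaves room to apply it to the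
set just after a new variable enters. -/
theorem Peels.two_mul_card_le_base {F : Formula n} (hF : F ⊆ allClauses n) {t : ℕ} (ht : 0 < t)
    (hprop : IsProportional F ((t : ℝ) / 10)) {B U : Finset (Fin n)} (h : Peels F t B U)
    (hcard : 5 / 2 * (B.card : ℝ) + 1 ≤ (n : ℝ) / 10 ^ 6) : 2 * U.card ≤ 5 * B.card := by
  induction h with
  | base => omega
  | step U x hU hx hlt ih =>
    have hp := Peels.step U x hU hx hlt
    have := hp.two_mul_card_le hF ht hprop (K := Finset.univ)
      (fun _ _ _ _ _ _ _ _ _ => Finset.mem_univ _) (by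
        rw [Finset.inter_univ, Finset.card_insert_of_notMem hx]
        have : (2 * U.card : ℝ) ≤ 5 * B.card := by exact_mod_cast ih
        push_cast
        linarith)
    rwa [Finset.inter_univ, Finset.inter_eq_right.2 hp.subset] at this

theorem restrict_mono (F : Formula n) {Z Z' : Finset (Fin n)} (h : Z ⊆ Z') :
    F.restrict Z ⊆ F.restrict Z' := fun C hC => by
  obtain ⟨h1, h2⟩ := Finset.mem_filter.1 hC
  exact Finset.mem_filter.2 ⟨h1, h2.trans h⟩

theorem exists_isMaximalCore (F : Formula n) (ψ : Assignment n) (t : ℕ) :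
    ∃ H, IsMaximalCore F ψ t H := by
  classical
  set H : Finset (Fin n) := Finset.univ.filter fun x => ∃ Z, IsCore F ψ t Z ∧ x ∈ Z with hH
  have hsub : ∀ Z, IsCore F ψ t Z → Z ⊆ H := fun Z hZ x hx =>
    Finset.mem_filter.2 ⟨Finset.mem_univ _, Z, hZ, hx⟩
  refine ⟨H, ⟨fun x hx => ?_, fun x hx => ?_⟩, hsub⟩
  · obtain ⟨-, Z, hZ, hxZ⟩ := Finset.mem_filter.1 hx
    exact (hZ.1 x hxZ).trans (Finset.card_le_card
      (Finset.filter_subset_filter _ (restrict_mono F (hsub Z hZ))))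
  · obtain ⟨-, Z, hZ, hxZ⟩ := Finset.mem_filter.1 hx
    refine le_trans ?_ (hZ.2 x hxZ)
    exact_mod_cast Finset.card_le_card (Finset.filter_subset_filter _
      (Finset.sdiff_subset_sdiff (Finset.Subset.refl _) (restrict_mono F (hsub Z hZ))))

/-- Two satisfying assignments that are close on a core agree on it. -/
theorem IsCore.eq_of_close {F : Formula n} {ψ φ : Assignment n} {t : ℕ} {H : Finset (Fin n)}
    (hF : F ⊆ allClauses n) (hH : IsCore F ψ t H) (hprop : IsProportional F ((t : ℝ) / 10))
    (hφ : Satisfies φ F)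
    (hclose : ((Finset.univ.filter fun x => φ x ≠ ψ x).card : ℝ) ≤ (n : ℝ) / 10 ^ 6) :
    ∀ x ∈ H, φ x = ψ x := by
  classical
  set U := H.filter fun x => φ x ≠ ψ x with hU
  by_contra hcon
  push Not at hcon
  obtain ⟨x₀, hx₀, hne⟩ := hcon
  refine hprop ⟨U, ⟨x₀, Finset.mem_filter.2 ⟨hx₀, hne⟩⟩, le_trans ?_ hclose, ?_⟩
  · exact_mod_cast Finset.card_le_card (Finset.filter_subset_filter _ (Finset.subset_univ H))
  · have hsub : (U.biUnion fun x => (F.restrict H).filter fun C => Supports ψ x C) ⊆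
        F.filter fun C => 2 ≤ (C.vars ∩ U).card := by
      intro C hC
      obtain ⟨x, hx, hC⟩ := Finset.mem_biUnion.1 hC
      obtain ⟨hCH, hs⟩ := Finset.mem_filter.1 hC
      obtain ⟨hCF, hCs⟩ := Finset.mem_filter.1 hCH
      refine Finset.mem_filter.2 ⟨hCF, ?_⟩
      have hxC := hs.mem_vars
      obtain ⟨l, hl, hlx, hlt, hlu⟩ := hs
      obtain ⟨l', hl', hlt'⟩ := hφ C hCF
      have hl'C : l'.1 ∈ C.vars := mem_vars.2 ⟨l', hl', rfl⟩
      have hxφ := (Finset.mem_filter.1 hx).2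
      have hll' : l' ≠ l := by
        rintro rfl
        unfold LitTrue at hlt hlt'
        rw [← hlx, hlt, hlt'] at hxφ
        exact hxφ rfl
      have hfalse : ¬ LitTrue ψ l' := fun h => hll' (hlu l' hl' h)
      have hdiff : φ l'.1 ≠ ψ l'.1 := by
        intro h
        unfold LitTrue at hfalse hlt'
        exact hfalse (h ▸ hlt')
      have hne' : x ≠ l'.1 := by
        rintro rfl
        exact hll' (injOn_fst_clause (hF hCF) hl' hl hlx.symm)
      calc 2 = ({x, l'.1} : Finset (Fin n)).card := (Finset.card_pair hne').symm
        _ ≤ _ := Finset.card_le_card (by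
          intro z hz
          rcases Finset.mem_insert.1 hz with rfl | hz
          · exact Finset.mem_inter.2 ⟨hxC, hx⟩
          · rw [Finset.mem_singleton.1 hz]
            exact Finset.mem_inter.2 ⟨hl'C, Finset.mem_filter.2 ⟨hCs hl'C, hdiff⟩⟩)
    have hcard : t * U.card ≤
        (U.biUnion fun x => (F.restrict H).filter fun C => Supports ψ x C).card := by
      -- A clause has at most one supporter, so the families for different `x` are disjoint.
      rw [Finset.card_biUnion]
      · rw [mul_comm, ← smul_eq_mul, ← Finset.sum_const]
        refine Finset.sum_le_sum fun x hx => ?_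
        convert hH.1 x (Finset.mem_filter.1 hx).1
      · intro x _ y _ hxy
        rw [Function.onFun, Finset.disjoint_left]
        intro C hC hC'
        exact hxy ((Finset.mem_filter.1 hC).2.unique (Finset.mem_filter.1 hC').2)
    have h2 : (t * U.card : ℝ) ≤ (F.filter fun C => 2 ≤ (C.vars ∩ U).card).card := by
      exact_mod_cast hcard.trans (Finset.card_le_card hsub)
    have h3 : (0 : ℝ) ≤ t * U.card := by positivity
    linarith

/-- Unit propagation: by induction the other two literals are false under `φ` as well, so the clause
forces the literal of the new satellite in both assignments. -/
theorem IsSatellite.eq_of_eq_on {F : Formula n} {ψ φ : Assignment n} {H : Finset (Fin n)}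
    (hψ : Satisfies ψ F) (hφ : Satisfies φ F) (h : ∀ x ∈ H, φ x = ψ x) {i : ℕ} {x : Fin n}
    (hx : IsSatellite F ψ H i x) : φ x = ψ x := by
  induction hx with
  | core x hx => exact h x hx
  | step i b l l₁ l₂ _ hmem _ _ _ hf₁ hf₂ _ _ ih₁ ih₂ =>
    have key : ∀ χ : Assignment n, Satisfies χ F → χ l₁.1 = ψ l₁.1 → χ l₂.1 = ψ l₂.1 →
        χ l.1 = l.2 := by
      intro χ hχ h₁ h₂
      obtain ⟨l', hl', ht⟩ := hχ _ hmem
      simp only [Finset.mem_insert, Finset.mem_singleton] at hl'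
      unfold LitTrue at hf₁ hf₂ ht
      rcases hl' with rfl | rfl | rfl
      · exact ht
      · exact absurd (h₁ ▸ ht) hf₁
      · exact absurd (h₂ ▸ ht) hf₂
    rw [key φ hφ ih₁ ih₂, key ψ hψ rfl rfl]

theorem isFrozen_union_satellites {F : Formula n} {ψ : Assignment n} {t : ℕ}
    {H : Finset (Fin n)} (hF : F ⊆ allClauses n) (hψ : Satisfies ψ F) (hH : IsCore F ψ t H)
    (hprop : IsProportional F ((t : ℝ) / 10))
    (hclose : ∀ φ, Satisfies φ F →
      ((Finset.univ.filter fun x => φ x ≠ ψ x).card : ℝ) ≤ (n : ℝ) / 10 ^ 6) :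
    IsFrozen F (H ∪ satellites F ψ H) := by
  classical
  have key : ∀ x ∈ H ∪ satellites F ψ H, ∀ φ, Satisfies φ F → φ x = ψ x := by
    intro x hx φ hφ
    have hφH := hH.eq_of_close hF hprop hφ (hclose φ hφ)
    rcases Finset.mem_union.1 hx with h | h
    · exact hφH x h
    · unfold satellites at h
      obtain ⟨-, b, -, hb⟩ := Finset.mem_filter.1 h
      exact hb.eq_of_eq_on hψ hφ hφH
  intro x hx φ₁ φ₂ h₁ h₂
  rw [key x hx φ₁ h₁, key x hx φ₂ h₂]

end Core

/-! ### Components outside the core -/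

section Components

variable {n : ℕ}

/-- The graph on `B` in which two variables are adjacent if some clause of `F` contains both. -/
def clusterGraph (F : Formula n) (B : Finset (Fin n)) : SimpleGraph (Fin n) where
  Adj x y := x ≠ y ∧ x ∈ B ∧ y ∈ B ∧ ∃ C ∈ F, x ∈ C.vars ∧ y ∈ C.vars
  symm := ⟨fun _ _ h => ⟨h.1.symm, h.2.2.1, h.2.1, h.2.2.2.imp fun _ hC => ⟨hC.1, hC.2.2, hC.2.1⟩⟩⟩
  loopless := ⟨fun _ h => h.1 rfl⟩

theorem graph_out_le_clusterGraph (F : Formula n) (ψ : Assignment n) {A B : Finset (Fin n)}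
    (h : ∀ x ∉ A, x ∈ B) : (F.out A ψ).graph ≤ clusterGraph F B := by
  classical
  intro x y hxy
  obtain ⟨hne, C, hC, hx, hy⟩ := hxy
  unfold Formula.out at hC
  obtain ⟨C', hC', rfl⟩ := Finset.mem_image.1 hC
  obtain ⟨l, hl, rfl⟩ := mem_vars.1 hx
  obtain ⟨l', hl', rfl⟩ := mem_vars.1 hy
  obtain ⟨hlC, hlA⟩ := Finset.mem_filter.1 hl
  obtain ⟨hlC', hlA'⟩ := Finset.mem_filter.1 hl'
  exact ⟨hne, h _ hlA, h _ hlA', C', (Finset.mem_filter.1 hC').1, mem_vars.2 ⟨l, hlC, rfl⟩,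
    mem_vars.2 ⟨l', hlC', rfl⟩⟩

open Classical in
/-- The component of `x` in the cluster graph. -/
noncomputable def cluster (F : Formula n) (B : Finset (Fin n)) (x : Fin n) : Finset (Fin n) :=
  Finset.univ.filter fun y => (clusterGraph F B).Reachable x y

theorem mem_cluster {F : Formula n} {B : Finset (Fin n)} {x y : Fin n} :
    y ∈ cluster F B x ↔ (clusterGraph F B).Reachable x y := by
  classical
  simp [cluster]

theorem cluster_closed {F : Formula n} {B : Finset (Fin n)} {x y z : Fin n}
    (hy : y ∈ cluster F B x) (hyB : y ∈ B) (hzB : z ∈ B) {C : Clause n} (hC : C ∈ F)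
    (hyC : y ∈ C.vars) (hzC : z ∈ C.vars) : z ∈ cluster F B x := by
  by_cases h : y = z
  · rwa [← h]
  · rw [mem_cluster] at hy ⊢
    have : (clusterGraph F B).Adj y z := ⟨h, hyB, hzB, C, hC, hyC, hzC⟩
    exact hy.trans this.reachable

theorem exists_adj_of_card_cluster {F : Formula n} {B : Finset (Fin n)} {x : Fin n}
    (h : 2 ≤ (cluster F B x).card) {y : Fin n} (hy : y ∈ cluster F B x) :
    ∃ z, (clusterGraph F B).Adj y z := by
  obtain ⟨z, hz, hne⟩ := Finset.exists_mem_ne (s := cluster F B x) (by omega) y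
  have hr : (clusterGraph F B).Reachable y z := (mem_cluster.1 hy).symm.trans (mem_cluster.1 hz)
  obtain ⟨w⟩ := hr
  cases w with
  | nil => exact absurd rfl hne
  | cons hadj _ => exact ⟨_, hadj⟩

theorem cluster_subset {F : Formula n} {B : Finset (Fin n)} {x : Fin n}
    (h : 2 ≤ (cluster F B x).card) : cluster F B x ⊆ B := by
  intro y hy
  obtain ⟨z, hz⟩ := exists_adj_of_card_cluster h hy
  exact hz.2.1

/-- A nontrivial cluster is covered by a connected set of fewer clauses than it has variables. -/
theorem exists_tree_of_cluster {F : Formula n} (hF : F ⊆ allClauses n) {B : Finset (Fin n)}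
    {x : Fin n} (h : 2 ≤ (cluster F B x).card) :
    ∃ T ⊆ F, ∃ C₀ ∈ allClauses n, 0 < T.card ∧ T ∈ treeSets clauseNbrs (T.card - 1) C₀ ∧
      T.card + 1 ≤ (cluster F B x).card ∧ cluster F B x ⊆ T.vars := by
  classical
  set K := cluster F B x with hK
  have hxK : x ∈ K := mem_cluster.2 (SimpleGraph.Reachable.refl _)
  obtain ⟨y, hxy⟩ := exists_adj_of_card_cluster h hxK
  have hyK : y ∈ K := mem_cluster.2 hxy.reachable
  obtain ⟨hne, hxB, hyB, C₀, hC₀, hxC₀, hyC₀⟩ := hxy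
  -- Take a largest connected `T` meeting `K` in more than |T| variables. If it missed part of `K`,
  -- an edge leaving the covered part would provide another clause with a new variable of `K`.
  set 𝒯 : Finset (Formula n) := F.powerset.filter fun T => 0 < T.card ∧
    T ∈ treeSets clauseNbrs (T.card - 1) C₀ ∧ T.card + 1 ≤ (K ∩ T.vars).card with h𝒯
  have hne𝒯 : 𝒯.Nonempty := by
    refine ⟨{C₀}, ?_⟩
    simp only [h𝒯, Finset.mem_filter, Finset.mem_powerset, Finset.singleton_subset_iff,
      Finset.card_singleton]
    refine ⟨hC₀, one_pos, by simp [treeSets], ?_⟩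
    calc 1 + 1 = ({x, y} : Finset (Fin n)).card := (Finset.card_pair hne).symm
      _ ≤ _ := Finset.card_le_card (by
        intro z hz
        simp only [Formula.vars, Finset.singleton_biUnion]
        rcases Finset.mem_insert.1 hz with rfl | hz
        · exact Finset.mem_inter.2 ⟨hxK, hxC₀⟩
        · rw [Finset.mem_singleton.1 hz]
          exact Finset.mem_inter.2 ⟨hyK, hyC₀⟩)
  obtain ⟨T, hT, hmax⟩ := Finset.exists_max_image 𝒯 Finset.card hne𝒯
  simp only [h𝒯, Finset.mem_filter, Finset.mem_powerset] at hT hmax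
  obtain ⟨hTF, hT0, hTt, hTc⟩ := hT
  refine ⟨T, hTF, C₀, hF hC₀, hT0, hTt,
    hTc.trans (Finset.card_le_card Finset.inter_subset_left), ?_⟩
  by_contra hcov
  obtain ⟨b, hbK, hbT⟩ := Finset.not_subset.1 hcov
  obtain ⟨a, ha⟩ : (K ∩ T.vars).Nonempty := Finset.card_pos.1 (by omega)
  have hr : (clusterGraph F B).Reachable a b :=
    (mem_cluster.1 (Finset.mem_inter.1 ha).1).symm.trans (mem_cluster.1 hbK)
  obtain ⟨w⟩ := hr
  obtain ⟨d, -, hd1, hd2⟩ := w.exists_boundary_dart {z | z ∈ K ∩ T.vars} ha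
    (fun hb => hbT (Finset.mem_inter.1 (show b ∈ K ∩ T.vars from hb)).2)
  obtain ⟨hd1K, hd1T⟩ := Finset.mem_inter.1 (show d.fst ∈ K ∩ T.vars from hd1)
  have hd2K : d.snd ∈ K := mem_cluster.2 ((mem_cluster.1 hd1K).trans d.adj.reachable)
  have hd2T : d.snd ∉ T.vars := fun hh =>
    hd2 (show d.snd ∈ K ∩ T.vars from Finset.mem_inter.2 ⟨hd2K, hh⟩)
  obtain ⟨-, -, -, C, hCF, hC1, hC2⟩ := d.adj
  obtain ⟨C', hC'T, hC'1⟩ := Finset.mem_biUnion.1 hd1T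
  have hCT : C ∉ T := fun hh => hd2T (Finset.mem_biUnion.2 ⟨C, hh, hC2⟩)
  have hnbr : C ∈ clauseNbrs C' := by
    unfold clauseNbrs
    rw [if_pos (hF (hTF hC'T))]
    exact Finset.mem_biUnion.2 ⟨_, hC'1, Finset.mem_filter.2 ⟨hF hCF, hC1⟩⟩
  have hins := insert_mem_treeSets hTt hC'T hnbr
  have := hmax (insert C T) ⟨Finset.insert_subset hCF hTF, by
      rw [Finset.card_insert_of_notMem hCT]; omega, by
      rw [Finset.card_insert_of_notMem hCT]
      rwa [show T.card - 1 + 1 = T.card + 1 - 1 by omega] at hins, by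
      rw [Finset.card_insert_of_notMem hCT]
      have hsub : insert d.snd (K ∩ T.vars) ⊆ K ∩ (insert C T).vars := by
        intro z hz
        simp only [Formula.vars, Finset.biUnion_insert, Finset.mem_inter, Finset.mem_union]
        rcases Finset.mem_insert.1 hz with rfl | hz
        · exact ⟨hd2K, Or.inl hC2⟩
        · exact ⟨(Finset.mem_inter.1 hz).1, Or.inr (Finset.mem_inter.1 hz).2⟩
      have h1 := Finset.card_le_card hsub
      rw [Finset.card_insert_of_notMem hd2] at h1
      omega⟩
  rw [Finset.card_insert_of_notMem hCT] at this
  omega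

/-- The potential witnesses of a large component outside the core: a connected set `T` of clauses
together with a large set of variables of `T`. -/
def IsTreeWitness (T : Formula n) (K : Finset (Fin n)) : Prop :=
  T ⊆ allClauses n ∧ 0 < T.card ∧ T.card ≤ n ∧ Real.log n < 3 * (T.card : ℝ) ∧
    (∃ C₀ ∈ allClauses n, T ∈ treeSets clauseNbrs (T.card - 1) C₀) ∧
    K ⊆ T.vars ∧ 2 * T.card ≤ 5 * K.card

/-- The deterministic part of the proof. -/
theorem exists_core_structure {F : Formula n} (hF : F ⊆ allClauses n) {ψ : Assignment n}
    (hψ : Satisfies ψ F) {t : ℕ} (ht : 0 < t) (hprop : IsProportional F ((t : ℝ) / 10))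
    (hclose : ∀ φ, Satisfies φ F →
      ((Finset.univ.filter fun x => φ x ≠ ψ x).card : ℝ) ≤ (n : ℝ) / 10 ^ 6)
    (hlog : 1 ≤ Real.log n) {κ : ℝ}
    (hκ : κ + 1 ≤ (n : ℝ) / 10 ^ 6)
    (hlow : 5 / 2 * ((lowSupport F ψ (2 * t)).card : ℝ) ≤ κ)
    (htree : ∀ T K, IsTreeWitness T K → T ⊆ F → ¬ K ⊆ lowSupport F ψ (2 * t)) :
    ∃ H, IsMaximalCore F ψ t H ∧ (n : ℝ) - κ ≤ H.card ∧
      IsFrozen F (H ∪ satellites F ψ H) ∧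
      ComponentsAtMost (F.out (H ∪ satellites F ψ H) ψ) (Real.log (n : ℝ)) := by
  classical
  set B₀ := lowSupport F ψ (2 * t) with hB₀
  obtain ⟨B, hB, hBmax⟩ := exists_peels_maximal F t B₀
  have hBcard := hB.two_mul_card_le_base hF ht hprop (by linarith)
  have hBκ : (B.card : ℝ) ≤ κ := by
    have : (2 * B.card : ℝ) ≤ 5 * B₀.card := by exact_mod_cast hBcard
    linarith
  have hcore := isCore_compl hB.subset hBmax
  obtain ⟨H, hH⟩ := exists_isMaximalCore F ψ t
  have hBH := hH.2 _ hcore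
  refine ⟨H, hH, ?_, isFrozen_union_satellites hF hψ hH.1 hprop hclose, ?_⟩
  · have h1 := Finset.card_le_card hBH
    rw [Finset.card_compl, Fintype.card_fin] at h1
    have h2 : (n : ℝ) ≤ H.card + B.card := by exact_mod_cast (by omega)
    linarith
  · intro Γ
    by_contra hbig
    rw [not_le] at hbig
    induction Γ using SimpleGraph.ConnectedComponent.ind with
    | _ x =>
      set K := cluster F B x with hK
      have hsub : (((F.out (H ∪ satellites F ψ H) ψ).graph.connectedComponentMk x).supp :
          Set (Fin n)) ⊆ (K : Set (Fin n)) := by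
        intro y hy
        have hr : (F.out (H ∪ satellites F ψ H) ψ).graph.Reachable y x :=
          SimpleGraph.ConnectedComponent.exact hy
        refine mem_cluster.2 (hr.symm.mono (graph_out_le_clusterGraph F ψ fun z hz => ?_))
        by_contra hzB
        exact hz (Finset.mem_union_left _ (hBH (Finset.mem_compl.2 hzB)))
      have hcard := Set.ncard_le_ncard hsub (Finset.finite_toSet K)
      rw [Set.ncard_coe_finset] at hcard
      have hKlog : Real.log n < (K.card : ℝ) :=
        hbig.trans_le (by exact_mod_cast hcard)
      have hK2 : 2 ≤ K.card := by
        have : (1 : ℝ) < K.card := hlog.trans_lt hKlog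
        exact_mod_cast this
      have hKB := cluster_subset hK2
      obtain ⟨T, hTF, C₀, hC₀, hT0, hTt, hTK, hKT⟩ := exists_tree_of_cluster hF hK2
      rw [← hK] at hTK hKT
      -- Localised peeling at `K` puts at least 2/5 of `K` in `B₀`; as |T| < |K| ≤ 3|T|, this gives
      -- both the size of `K ∩ B₀` and the logarithmic lower bound on |T|.
      have hBK : B ∩ K = K := Finset.inter_eq_right.2 hKB
      have hhalf := hB.two_mul_card_le hF ht hprop (K := K)
        (fun y hy z hz hyB C hC hyC hzC => cluster_closed hy hyB hz hC hyC hzC) (by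
          rw [hBK]
          have : (K.card : ℝ) ≤ B.card := by exact_mod_cast Finset.card_le_card hKB
          linarith)
      rw [hBK] at hhalf
      have hTa := hTF.trans hF
      have h3 := (Finset.card_le_card hKT).trans (card_formula_vars_le hTa)
      refine htree T (K ∩ B₀) ⟨hTa, hT0, ?_, ?_, ⟨C₀, hC₀, hTt⟩,
        Finset.inter_subset_left.trans hKT, by omega⟩ hTF Finset.inter_subset_right
      · have : K.card ≤ n := (Finset.card_le_univ K).trans_eq (Fintype.card_fin n)
        omega
      · exact hKlog.trans_le (by exact_mod_cast h3)

end Components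

/-! ### Probability estimates -/

section Estimates

variable {n : ℕ}

/-- The clause on the variables `Z` whose only falsifying values are those opposite to `χ`. -/
def clauseOf (χ : Assignment n) (Z : Finset (Fin n)) : Clause n := Z.image fun z => (z, χ z)

theorem vars_clauseOf (χ : Assignment n) (Z : Finset (Fin n)) : (clauseOf χ Z).vars = Z := by
  simp [clauseOf, Clause.vars, Finset.image_image, Function.comp_def]

theorem mem_clauseOf {χ : Assignment n} {Z : Finset (Fin n)} {l : Literal n} :
    l ∈ clauseOf χ Z ↔ l.1 ∈ Z ∧ l.2 = χ l.1 := by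
  obtain ⟨x, b⟩ := l
  simp only [clauseOf, Finset.mem_image, Prod.mk.injEq]
  constructor
  · rintro ⟨z, hz, rfl, rfl⟩
    exact ⟨hz, rfl⟩
  · rintro ⟨hx, rfl⟩
    exact ⟨x, hx, rfl, rfl⟩

theorem clauseOf_injective (χ : Assignment n) : Function.Injective (clauseOf χ) := fun Z Z' h => by
  rw [← vars_clauseOf χ Z, h, vars_clauseOf]

theorem clauseOf_mem_allClauses (χ : Assignment n) {Z : Finset (Fin n)} (hZ : Z.card = 3) :
    clauseOf χ Z ∈ allClauses n := by
  refine Finset.mem_filter.2 ⟨Finset.mem_powersetCard.2 ⟨Finset.subset_univ _, ?_⟩, ?_⟩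
  · rw [clauseOf, Finset.card_image_of_injective _ fun a b h => (Prod.mk.inj h).1, hZ]
  · rw [vars_clauseOf, hZ]

theorem card_triples_through (x : Fin n) :
    ((Finset.powersetCard 3 (Finset.univ : Finset (Fin n))).filter fun Z => x ∈ Z).card =
      (n - 1).choose 2 := by
  have e : ((Finset.powersetCard 3 (Finset.univ : Finset (Fin n))).filter fun Z => x ∈ Z) =
      (Finset.powersetCard 2 (Finset.univ.erase x)).image (insert x) := by
    ext Z
    simp only [Finset.mem_filter, Finset.mem_powersetCard, Finset.subset_univ, true_and,
      Finset.mem_image]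
    constructor
    · rintro ⟨hZ, hx⟩
      exact ⟨Z.erase x, ⟨Finset.erase_subset_erase _ (Finset.subset_univ _), by
        rw [Finset.card_erase_of_mem hx, hZ]⟩, Finset.insert_erase hx⟩
    · rintro ⟨P, ⟨hP, hPc⟩, rfl⟩
      have : x ∉ P := fun h => (Finset.mem_erase.1 (hP h)).1 rfl
      exact ⟨by rw [Finset.card_insert_of_notMem this, hPc], Finset.mem_insert_self _ _⟩
  rw [e, Finset.card_image_of_injOn, Finset.card_powersetCard,
    Finset.card_erase_of_mem (Finset.mem_univ x), Finset.card_univ, Fintype.card_fin]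
  intro P hP P' hP' h
  have hx : ∀ R ∈ Finset.powersetCard 2 (Finset.univ.erase x), x ∉ R := fun R hR hxR =>
    (Finset.mem_erase.1 ((Finset.mem_powersetCard.1 hR).1 hxR)).1 rfl
  rw [← Finset.erase_insert (hx P hP), ← Finset.erase_insert (hx P' hP')]
  exact congrArg (fun Z => Z.erase x) h

/-- Each triple through `x` carries a clause with the literal of `x` true and the other two false
under `ψ`. -/
theorem card_supported_allClauses_ge (ψ : Assignment n) (x : Fin n) :
    (n - 1).choose 2 ≤ (supported (allClauses n) ψ x).card := by
  classical
  rw [← card_triples_through x,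
    ← Finset.card_image_of_injective _ (clauseOf_injective fun z => if z = x then ψ z else !ψ z)]
  refine Finset.card_le_card fun C hC => ?_
  obtain ⟨Z, hZ, rfl⟩ := Finset.mem_image.1 hC
  simp only [Finset.mem_filter, Finset.mem_powersetCard, Finset.subset_univ, true_and] at hZ
  refine Finset.mem_filter.2 ⟨clauseOf_mem_allClauses _ hZ.1, (x, ψ x),
    mem_clauseOf.2 ⟨hZ.2, by simp⟩, rfl, rfl, ?_⟩
  rintro ⟨y, b⟩ hl ht
  obtain ⟨-, hb⟩ := mem_clauseOf.1 hl
  unfold LitTrue at ht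
  simp only at hb ht
  by_cases hy : y = x
  · rw [← ht, hy]
  · rw [if_neg hy, ← ht] at hb
    simp at hb

/-- The probability that all the variables of `K` support few clauses while all the clauses of `T`
are present. -/
theorem sum_binExp_lowSupport_le (σ : ClauseOrder n) {p : ℝ} (h0 : 0 ≤ p) (h1 : p ≤ 1)
    {T : Formula n} (hT : T ⊆ allClauses n) (K : Finset (Fin n)) (r : ℕ) :
    ∑ ψ, binExp p (allClauses n) (fun S => solutionWeight ψ (satFormula σ S) *
      ind (T ⊆ satFormula σ S ∧ K ⊆ lowSupport (satFormula σ S) ψ r)) ≤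
      p ^ T.card * (2 ^ r * (1 - p / 2) ^ (n - 1).choose 2) ^ K.card := by
  classical
  -- Exponential Markov: low support of all of `K` means at most r|K| supported clauses, so 2^(r|K|)
  -- (1/2)^(number of them) is at least 1. Supported families are disjoint, whence |K| · C(n-1, 2)
  -- independent tosses.
  have key := sum_binExp_solutionWeight_le σ h0 h1 (y := 1 / 2) (by norm_num) (by norm_num) hT
    (fun ψ => K.biUnion fun x => supported (allClauses n) ψ x)
    (fun ψ C hC => by
      obtain ⟨x, -, hx⟩ := Finset.mem_biUnion.1 hC
      obtain ⟨hCa, l, hl, -, ht, -⟩ := Finset.mem_filter.1 hx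
      exact mem_trueClauses.2 ⟨hCa, l, hl, ht⟩)
    (N := K.card * (n - 1).choose 2) (fun ψ => by
      rw [Finset.card_biUnion]
      · rw [← smul_eq_mul, ← Finset.sum_const]
        exact Finset.sum_le_sum fun x _ => card_supported_allClauses_ge ψ x
      · intro x _ y _ hxy
        rw [Function.onFun, Finset.disjoint_left]
        intro C hC hC'
        exact hxy ((Finset.mem_filter.1 hC).2.unique (Finset.mem_filter.1 hC').2))
  have e : p ^ T.card * (2 ^ r * (1 - p / 2) ^ (n - 1).choose 2) ^ K.card =
      2 ^ (r * K.card) * (p ^ T.card * (1 - p + p * (1 / 2)) ^ (K.card * (n - 1).choose 2)) := by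
    rw [mul_pow, ← pow_mul, ← pow_mul, mul_comm (Nat.choose _ _),
      show 1 - p + p * (1 / 2) = 1 - p / 2 by ring]
    ring
  rw [e]
  refine le_trans ?_ (mul_le_mul_of_nonneg_left key (by positivity))
  rw [Finset.mul_sum]
  refine Finset.sum_le_sum fun ψ _ => ?_
  rw [← binExp_const_mul]
  refine binExp_mono h0 h1 fun S hS => ?_
  have hw := solutionWeight_nonneg ψ (satFormula σ S)
  set F := satFormula σ S with hF
  by_cases hTK : T ⊆ F ∧ K ⊆ lowSupport F ψ r
  · rw [ind_pos hTK, if_pos hTK.1]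
    have hcard : (F ∩ K.biUnion fun x => supported (allClauses n) ψ x).card ≤ r * K.card := by
      have hsub : (F ∩ K.biUnion fun x => supported (allClauses n) ψ x) ⊆
          K.biUnion fun x => supported F ψ x := by
        intro C hC
        obtain ⟨hCF, hC⟩ := Finset.mem_inter.1 hC
        obtain ⟨x, hx, hCx⟩ := Finset.mem_biUnion.1 hC
        exact Finset.mem_biUnion.2 ⟨x, hx, Finset.mem_filter.2 ⟨hCF, (Finset.mem_filter.1 hCx).2⟩⟩
      refine (Finset.card_le_card hsub).trans (Finset.card_biUnion_le.trans ?_)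
      rw [mul_comm, ← smul_eq_mul, ← Finset.sum_const]
      exact Finset.sum_le_sum fun x hx => (Finset.mem_filter.1 (hTK.2 hx)).2.le
    have hpow : (1 : ℝ) ≤ 2 ^ (r * K.card) *
        (1 / 2) ^ (F ∩ K.biUnion fun x => supported (allClauses n) ψ x).card := by
      rw [one_div, inv_pow, ← div_eq_mul_inv, one_le_div (by positivity)]
      exact pow_le_pow_right₀ (by norm_num) hcard
    calc _ = solutionWeight ψ F * 1 := rfl
      _ ≤ solutionWeight ψ F * (2 ^ (r * K.card) *
        (1 / 2) ^ (F ∩ K.biUnion fun x => supported (allClauses n) ψ x).card) :=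
          mul_le_mul_of_nonneg_left hpow hw
      _ = _ := by ring
  · rw [ind_neg hTK, mul_zero]
    refine mul_nonneg (by positivity) (mul_nonneg (mul_nonneg hw ?_) (by positivity))
    split_ifs <;> norm_num

/-- The variables on which two assignments differ. -/
def disagree (φ ψ : Assignment n) : Finset (Fin n) := Finset.univ.filter fun x => φ x ≠ ψ x

/-- The probability that two given assignments both satisfy the outcome. -/
theorem binExp_both_satisfy_le (σ : ClauseOrder n) {p : ℝ} (h0 : 0 ≤ p) (h1 : p ≤ 1)
    (φ ψ : Assignment n) :
    binExp p (allClauses n) (fun S =>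
      ind (Satisfies φ (satFormula σ S) ∧ Satisfies ψ (satFormula σ S))) ≤
      Real.exp (-(p * (n - 1).choose 2 * (disagree φ ψ).card / 3)) := by
  classical
  set Zs := (Finset.powersetCard 3 (Finset.univ : Finset (Fin n))).filter
    fun Z => (Z ∩ disagree φ ψ).Nonempty with hZs
  -- These clauses are false under `φ` and true under `ψ`. A successful one would be forced in by
  -- `ψ` and contradict `φ`, so all their tosses must fail.
  set Q := Zs.image (clauseOf fun z => !φ z) with hQ
  have hQa : Q ⊆ allClauses n := by
    intro C hC
    obtain ⟨Z, hZ, rfl⟩ := Finset.mem_image.1 hC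
    exact clauseOf_mem_allClauses _ (Finset.mem_powersetCard.1 (Finset.mem_filter.1 hZ).1).2
  have hcard : (disagree φ ψ).card * (n - 1).choose 2 ≤ 3 * Q.card := by
    rw [hQ, Finset.card_image_of_injective _ (clauseOf_injective _)]
    calc (disagree φ ψ).card * (n - 1).choose 2
        = ∑ x ∈ disagree φ ψ, (Zs.filter fun Z => x ∈ Z).card := by
          rw [← smul_eq_mul, ← Finset.sum_const]
          refine Finset.sum_congr rfl fun x hx => ?_
          rw [← card_triples_through x]
          congr 1
          ext Z
          simp only [hZs, Finset.mem_filter]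
          exact ⟨fun h => ⟨⟨h.1, x, Finset.mem_inter.2 ⟨h.2, hx⟩⟩, h.2⟩, fun h => ⟨h.1.1, h.2⟩⟩
      _ = ∑ Z ∈ Zs, ((disagree φ ψ).filter fun x => x ∈ Z).card :=
          Finset.sum_card_bipartiteAbove_eq_sum_card_bipartiteBelow (fun x Z => x ∈ Z)
      _ ≤ ∑ Z ∈ Zs, 3 := by
          refine Finset.sum_le_sum fun Z hZ => ?_
          rw [← (Finset.mem_powersetCard.1 (Finset.mem_filter.1 hZ).1).2]
          exact Finset.card_le_card fun x hx => (Finset.mem_filter.1 hx).2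
      _ = 3 * Zs.card := by rw [Finset.sum_const, smul_eq_mul, mul_comm]
  have hle : binExp p (allClauses n) (fun S =>
      ind (Satisfies φ (satFormula σ S) ∧ Satisfies ψ (satFormula σ S))) ≤
      (1 - p) ^ Q.card := by
    have := binExp_pow_card_inter p 0 (allClauses n) Q
    rw [Finset.inter_eq_right.2 hQa, mul_zero, add_zero] at this
    rw [← this]
    refine binExp_mono h0 h1 fun S hS => ?_
    refine ind_le (by positivity) fun h => ?_
    have hSQ : S ∩ Q = ∅ := by
      rw [Finset.eq_empty_iff_forall_notMem]
      intro C hC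
      obtain ⟨hCS, hCQ⟩ := Finset.mem_inter.1 hC
      obtain ⟨Z, hZ, rfl⟩ := Finset.mem_image.1 hCQ
      obtain ⟨z, hz⟩ := (Finset.mem_filter.1 hZ).2
      obtain ⟨hzZ, hzd⟩ := Finset.mem_inter.1 hz
      have hzd := (Finset.mem_filter.1 hzd).2
      have hmem := mem_satFormula h.2 hCS (hS hCS) ⟨(z, !φ z), mem_clauseOf.2 ⟨hzZ, rfl⟩, by
        unfold LitTrue
        simp only
        cases h1 : φ z <;> cases h2 : ψ z <;> simp_all⟩
      obtain ⟨l, hl, ht⟩ := h.1 _ hmem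
      have := (mem_clauseOf.1 hl).2
      unfold LitTrue at ht
      rw [ht] at this
      simp at this
    simp [hSQ]
  refine hle.trans ?_
  have h2 : 1 - p ≤ Real.exp (-p) := by linarith [Real.add_one_le_exp (-p)]
  calc (1 - p) ^ Q.card ≤ Real.exp (-p) ^ Q.card := pow_le_pow_left₀ (by linarith) h2 _
    _ = Real.exp (Q.card * (-p)) := (Real.exp_nat_mul _ _).symm
    _ ≤ _ := by
      refine Real.exp_le_exp.2 ?_
      have h3 : ((disagree φ ψ).card * (n - 1).choose 2 : ℝ) ≤ 3 * Q.card := by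
        exact_mod_cast hcard
      nlinarith [mul_le_mul_of_nonneg_left h3 h0]

/-- The clauses with at least two variables in `U`. -/
def pairClauses (U : Finset (Fin n)) : Formula n :=
  (allClauses n).filter fun C => 2 ≤ (C.vars ∩ U).card

theorem card_pairClauses_le (U : Finset (Fin n)) :
    (pairClauses U).card ≤ 8 * U.card ^ 2 * n := by
  have hsub : pairClauses U ⊆ ((U ×ˢ (Finset.univ : Finset Bool)) ×ˢ
      (U ×ˢ (Finset.univ : Finset Bool)) ×ˢ (Finset.univ : Finset (Literal n))).image
      fun a => {a.1, a.2.1, a.2.2} := by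
    intro C hC
    obtain ⟨hCa, h2⟩ := Finset.mem_filter.1 hC
    obtain ⟨x, hx, y, hy, hxy⟩ := Finset.one_lt_card.1 h2
    obtain ⟨hxC, hxU⟩ := Finset.mem_inter.1 hx
    obtain ⟨hyC, hyU⟩ := Finset.mem_inter.1 hy
    obtain ⟨l, hl, rfl⟩ := mem_vars.1 hxC
    obtain ⟨l', hl', rfl⟩ := mem_vars.1 hyC
    have hne : l' ≠ l := fun h => hxy (by rw [h])
    have hc : ((C.erase l).erase l').card = 1 := by
      rw [Finset.card_erase_of_mem (Finset.mem_erase.2 ⟨hne, hl'⟩), Finset.card_erase_of_mem hl,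
        card_clause hCa]
    obtain ⟨l'', hl''⟩ := Finset.card_eq_one.1 hc
    refine Finset.mem_image.2 ⟨(l, l', l''), ?_, ?_⟩
    · simp [hxU, hyU]
    · simp only
      rw [← hl'', Finset.insert_erase (Finset.mem_erase.2 ⟨hne, hl'⟩), Finset.insert_erase hl]
  refine (Finset.card_le_card hsub).trans (Finset.card_image_le.trans (le_of_eq ?_))
  simp only [Finset.card_product, Finset.card_univ, Fintype.card_prod, Fintype.card_bool,
    Fintype.card_fin]
  ring

/-- Chernoff's bound for the number of successful clauses with two variables in `U`. -/
theorem binExp_pairClauses_le {p : ℝ} (h0 : 0 ≤ p) (h1 : p ≤ 1) (U : Finset (Fin n)) {z a : ℝ}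
    (hz : 1 ≤ z) :
    binExp p (allClauses n) (fun S => ind (a ≤ ((S ∩ pairClauses U).card : ℝ))) ≤
      Real.exp (p * z * (8 * (U.card : ℝ) ^ 2 * n) - a * Real.log z) := by
  classical
  have hz0 : 0 < z := by linarith
  have h := binExp_pow_card_inter p z (allClauses n) (pairClauses U)
  rw [Finset.inter_eq_right.2 (show pairClauses U ⊆ allClauses n from Finset.filter_subset _ _)] at h
  have h2 : 1 - p + p * z ≤ Real.exp (p * z) := by linarith [Real.add_one_le_exp (p * z)]
  have h3 : (1 - p + p * z) ^ (pairClauses U).card ≤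
      Real.exp (p * z * (8 * (U.card : ℝ) ^ 2 * n)) := by
    calc _ ≤ Real.exp (p * z) ^ (pairClauses U).card :=
          pow_le_pow_left₀ (by nlinarith) h2 _
      _ = Real.exp ((pairClauses U).card * (p * z)) := (Real.exp_nat_mul _ _).symm
      _ ≤ _ := by
        refine Real.exp_le_exp.2 ?_
        have : ((pairClauses U).card : ℝ) ≤ 8 * (U.card : ℝ) ^ 2 * n := by
          exact_mod_cast card_pairClauses_le U
        nlinarith [mul_le_mul_of_nonneg_left this (mul_nonneg h0 hz0.le)]
  rw [sub_eq_add_neg, Real.exp_add]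
  refine le_trans ?_ (mul_le_mul_of_nonneg_right h3 (Real.exp_pos _).le)
  rw [← h, ← binExp_mul_const]
  refine binExp_mono h0 h1 fun S _ => ?_
  refine ind_le (by positivity) fun ha => ?_
  rw [← Real.rpow_natCast, Real.rpow_def_of_pos hz0, ← Real.exp_add]
  refine Real.one_le_exp ?_
  nlinarith [Real.log_nonneg hz]

end Estimates

/-! ### Union bounds -/

section UnionBounds

variable {n : ℕ}

theorem choose_le_exp_pow {k : ℕ} (hk : 0 < k) :
    (n.choose k : ℝ) ≤ (Real.exp 1 * n / k) ^ k := by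
  have hk0 : (0 : ℝ) < k := by exact_mod_cast hk
  have h1 : (n.choose k : ℝ) ≤ (n : ℝ) ^ k / (k.factorial : ℝ) := Nat.choose_le_pow_div k n
  have h2 : (k : ℝ) ^ k / (k.factorial : ℝ) ≤ Real.exp k :=
    Real.pow_div_factorial_le_exp k hk0.le k
  have h3 : Real.exp k = Real.exp 1 ^ k := by rw [← Real.exp_nat_mul, mul_one]
  have hf : (0 : ℝ) < k.factorial := by exact_mod_cast k.factorial_pos
  rw [div_pow, mul_pow, ← h3, le_div_iff₀ (by positivity)]
  calc (n.choose k : ℝ) * (k : ℝ) ^ k ≤ (n : ℝ) ^ k / (k.factorial : ℝ) * (k : ℝ) ^ k :=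
        mul_le_mul_of_nonneg_right h1 (by positivity)
    _ = (k : ℝ) ^ k / (k.factorial : ℝ) * (n : ℝ) ^ k := by ring
    _ ≤ _ := mul_le_mul_of_nonneg_right h2 (by positivity)

/-- The tilt z = n/(1000u) turns the first exponent into Du/125, while the gain is at least DuL/200
with L = log z ≥ 6. The surplus absorbs the binomial coefficient, at most exp(3uL), and n³, at most
exp(9uL). -/
theorem proportional_term_le {p ρ : ℝ} (hD : 10 ^ 8 ≤ (n : ℝ) ^ 2 * p)
    (hρ : (n : ℝ) ^ 2 * p / 200 ≤ ρ) {u : ℕ} (hu : 0 < u) (hun : (u : ℝ) ≤ (n : ℝ) / 10 ^ 6) :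
    (n.choose u : ℝ) * Real.exp (p * (n / (1000 * u)) * (8 * (u : ℝ) ^ 2 * n) -
      ρ * u * Real.log (n / (1000 * u))) ≤ 1 / (n : ℝ) ^ 3 := by
  have hu1 : (1 : ℝ) ≤ u := by exact_mod_cast hu
  have hn : (0 : ℝ) < n := by
    rw [le_div_iff₀ (by norm_num)] at hun
    nlinarith
  set D := (n : ℝ) ^ 2 * p with hDdef
  set z : ℝ := n / (1000 * u) with hz
  set L := Real.log z with hL
  have hz1000 : 1000 ≤ z := by
    rw [hz, le_div_iff₀ (by positivity)]
    rw [le_div_iff₀ (by norm_num)] at hun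
    linarith
  have hz0 : 0 < z := by linarith
  have hL1000 : Real.log 1000 ≤ L := Real.log_le_log (by norm_num) hz1000
  have hL6 : 6 ≤ L := by
    refine le_trans ?_ hL1000
    rw [Real.le_log_iff_exp_le (by norm_num)]
    have h := Real.exp_one_lt_d9
    calc Real.exp 6 = Real.exp 1 ^ 6 := by rw [← Real.exp_nat_mul]; norm_num
      _ ≤ (3 : ℝ) ^ 6 := pow_le_pow_left₀ (Real.exp_pos 1).le (by linarith) 6
      _ ≤ 1000 := by norm_num
  have hmean : p * z * (8 * (u : ℝ) ^ 2 * n) = D * u / 125 := by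
    rw [hz, hDdef]
    field_simp
    ring
  have hchoose : (n.choose u : ℝ) ≤ Real.exp (3 * u * L) := by
    refine (choose_le_exp_pow hu).trans ?_
    have e : Real.exp (3 * u * L) = (z ^ 3) ^ u := by
      rw [show (3 * u * L : ℝ) = u * ((3 : ℕ) * L) by push_cast; ring, Real.exp_nat_mul,
        Real.exp_nat_mul, hL, Real.exp_log hz0]
    rw [e]
    refine pow_le_pow_left₀ (by positivity) ?_ u
    have e2 : Real.exp 1 * n / u = Real.exp 1 * 1000 * z := by
      rw [hz]
      field_simp
    rw [e2]
    have h := Real.exp_one_lt_d9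
    have h4 : Real.exp 1 * 1000 ≤ z ^ 2 := by nlinarith
    calc Real.exp 1 * 1000 * z ≤ z ^ 2 * z := mul_le_mul_of_nonneg_right h4 hz0.le
      _ = z ^ 3 := by ring
  have hlogn : Real.log n ≤ 3 * u * L := by
    have e : (n : ℝ) = z * (1000 * u) := by rw [hz]; field_simp
    rw [e, Real.log_mul (by positivity) (by positivity), Real.log_mul (by norm_num) (by positivity)]
    have := Real.log_le_sub_one_of_pos (show (0 : ℝ) < u by positivity)
    nlinarith
  have hexp : (1 : ℝ) / (n : ℝ) ^ 3 = Real.exp (-(3 * Real.log n)) := by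
    rw [Real.exp_neg, show (3 * Real.log n : ℝ) = (3 : ℕ) * Real.log n by norm_num,
      Real.exp_nat_mul, Real.exp_log hn, one_div]
  rw [hmean, hexp]
  refine (mul_le_mul_of_nonneg_right hchoose (Real.exp_pos _).le).trans ?_
  rw [← Real.exp_add]
  refine Real.exp_le_exp.2 ?_
  have hDu : 10 ^ 8 * (u : ℝ) ≤ D * u := mul_le_mul_of_nonneg_right hD (by positivity)
  have hDu0 : 0 ≤ D * u := by nlinarith
  have h5 : D / 200 * (u * L) ≤ ρ * (u * L) := mul_le_mul_of_nonneg_right hρ (by positivity)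
  have h6 : D * u * 6 ≤ D * u * L := mul_le_mul_of_nonneg_left hL6 hDu0
  have h7 : 10 ^ 8 * (u : ℝ) * L ≤ D * u * L := mul_le_mul_of_nonneg_right hDu (by linarith)
  have h8 : 0 ≤ u * L := by positivity
  nlinarith

/-- The outcome is proportional with high probability. -/
theorem binExp_not_proportional_le (σ : ClauseOrder n) {p ρ : ℝ} (h0 : 0 ≤ p) (h1 : p ≤ 1)
    (hD : 10 ^ 8 ≤ (n : ℝ) ^ 2 * p) (hρ : (n : ℝ) ^ 2 * p / 200 ≤ ρ) (hn : 0 < n) :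
    binExp p (allClauses n) (fun S => ind (¬ IsProportional (satFormula σ S) ρ)) ≤
      2 / (n : ℝ) ^ 2 := by
  classical
  set g : ℕ → ℝ := fun u => if 0 < u ∧ (u : ℝ) ≤ (n : ℝ) / 10 ^ 6 then
    Real.exp (p * (n / (1000 * u)) * (8 * (u : ℝ) ^ 2 * n) -
      ρ * u * Real.log (n / (1000 * u))) else 0 with hg
  have hn0 : (0 : ℝ) < n := by exact_mod_cast hn
  calc _ ≤ binExp p (allClauses n) (fun S => ∑ U ∈ (Finset.univ : Finset (Fin n)).powerset,
        (if 0 < U.card ∧ (U.card : ℝ) ≤ (n : ℝ) / 10 ^ 6 then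
          ind (ρ * U.card ≤ ((S ∩ pairClauses U).card : ℝ)) else 0)) := by
        refine binExp_mono h0 h1 fun S hS => ?_
        have hnn : ∀ U ∈ (Finset.univ : Finset (Fin n)).powerset,
            (0 : ℝ) ≤ (if 0 < U.card ∧ (U.card : ℝ) ≤ (n : ℝ) / 10 ^ 6 then
              ind (ρ * U.card ≤ ((S ∩ pairClauses U).card : ℝ)) else 0) := fun U _ => by
          split_ifs
          exacts [ind_nonneg _, le_rfl]
        refine ind_le (Finset.sum_nonneg hnn) fun h => ?_
        obtain ⟨U, hUne, hUn, hUc⟩ := not_not.1 h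
        refine le_trans ?_ (Finset.single_le_sum hnn
          (Finset.mem_powerset.2 (Finset.subset_univ U)))
        rw [if_pos ⟨hUne.card_pos, hUn⟩, ind_pos]
        refine hUc.trans ?_
        norm_cast
        refine Finset.card_le_card fun C hC => ?_
        obtain ⟨hCF, hC2⟩ := Finset.mem_filter.1 hC
        have hCS := satFormula_subset σ S hCF
        exact Finset.mem_inter.2 ⟨hCS, Finset.mem_filter.2 ⟨hS hCS, hC2⟩⟩
    _ ≤ ∑ U ∈ (Finset.univ : Finset (Fin n)).powerset, g U.card := by
        rw [binExp_sum]
        refine Finset.sum_le_sum fun U _ => ?_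
        simp only [hg]
        split_ifs with hU
        · refine binExp_pairClauses_le h0 h1 U ?_
          have hu : (0 : ℝ) < U.card := by exact_mod_cast hU.1
          rw [le_div_iff₀ (by positivity)]
          have := hU.2
          rw [le_div_iff₀ (by norm_num)] at this
          linarith
        · simp [binExp]
    _ = ∑ u ∈ Finset.range (n + 1), (n.choose u : ℝ) * g u := by
        rw [Finset.sum_powerset_apply_card, Finset.card_univ, Fintype.card_fin]
        simp only [nsmul_eq_mul]
    _ ≤ ∑ u ∈ Finset.range (n + 1), 1 / (n : ℝ) ^ 3 := by
        refine Finset.sum_le_sum fun u _ => ?_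
        simp only [hg]
        split_ifs with hu
        · exact proportional_term_le hD hρ hu.1 hu.2
        · rw [mul_zero]; positivity
    _ ≤ 2 / (n : ℝ) ^ 2 := by
        rw [Finset.sum_const, Finset.card_range, nsmul_eq_mul]
        have : (1 : ℝ) ≤ n := by exact_mod_cast hn
        rw [mul_one_div, div_le_div_iff₀ (by positivity) (by positivity)]
        push_cast
        nlinarith [pow_pos hn0 2]

/-- All solutions are close to each other with high probability. -/
theorem binExp_far_solutions_le (σ : ClauseOrder n) {p : ℝ} (h0 : 0 ≤ p) (h1 : p ≤ 1)
    (hD : 10 ^ 8 ≤ (n : ℝ) ^ 2 * p) (hn : 0 < n)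
    (hM : 2 / 5 * (n : ℝ) ^ 2 ≤ (n - 1).choose 2) :
    binExp p (allClauses n) (fun S => ind (∃ φ ψ, Satisfies φ (satFormula σ S) ∧
      Satisfies ψ (satFormula σ S) ∧ (n : ℝ) / 10 ^ 6 < (disagree φ ψ).card)) ≤
      1 / (n : ℝ) ^ 2 := by
  classical
  have hn0 : (0 : ℝ) < n := by exact_mod_cast hn
  -- The exponent at distance above n/10⁶ is at least (2/5) · 10⁸ · 10⁻⁶ · n/3 = 40n/3, which beats
  -- the 4ⁿ pairs.
  set ε := Real.exp (-(13 * (n : ℝ))) with hε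
  have hε0 : 0 ≤ ε := (Real.exp_pos _).le
  have hpair : ∀ φ ψ : Assignment n, binExp p (allClauses n) (fun S =>
      ind (Satisfies φ (satFormula σ S) ∧ Satisfies ψ (satFormula σ S) ∧
        (n : ℝ) / 10 ^ 6 < (disagree φ ψ).card)) ≤ ε := by
    intro φ ψ
    by_cases hfar : (n : ℝ) / 10 ^ 6 < (disagree φ ψ).card
    · have h := binExp_both_satisfy_le σ h0 h1 φ ψ
      simp only [hfar, and_true]
      refine h.trans (Real.exp_le_exp.2 ?_)
      have h2 : 2 / 5 * 10 ^ 8 ≤ p * (n - 1).choose 2 := by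
        nlinarith [mul_le_mul_of_nonneg_left hM h0]
      have h3 : 2 / 5 * 10 ^ 8 * ((n : ℝ) / 10 ^ 6) ≤
          p * (n - 1).choose 2 * (disagree φ ψ).card :=
        mul_le_mul h2 hfar.le (by positivity) (by positivity)
      linarith
    · simp only [hfar, and_false, ind_neg not_false]
      simpa [binExp] using hε0
  calc _ ≤ binExp p (allClauses n) (fun S => ∑ φ : Assignment n, ∑ ψ : Assignment n,
        ind (Satisfies φ (satFormula σ S) ∧ Satisfies ψ (satFormula σ S) ∧
        (n : ℝ) / 10 ^ 6 < (disagree φ ψ).card)) := by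
        refine binExp_mono h0 h1 fun S _ => ?_
        refine ind_le (Finset.sum_nonneg fun φ _ => Finset.sum_nonneg fun ψ _ => ind_nonneg _) ?_
        rintro ⟨φ, ψ, h⟩
        rw [← ind_pos h]
        exact (Finset.single_le_sum (f := fun ψ => ind (Satisfies φ (satFormula σ S) ∧
          Satisfies ψ (satFormula σ S) ∧ (n : ℝ) / 10 ^ 6 < (disagree φ ψ).card))
          (fun ψ _ => ind_nonneg _) (Finset.mem_univ ψ)).trans
          (Finset.single_le_sum (f := fun φ => ∑ ψ, ind (Satisfies φ (satFormula σ S) ∧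
            Satisfies ψ (satFormula σ S) ∧ (n : ℝ) / 10 ^ 6 < (disagree φ ψ).card))
            (fun φ _ => Finset.sum_nonneg fun ψ _ => ind_nonneg _) (Finset.mem_univ φ))
    _ ≤ ∑ _φ : Assignment n, ∑ _ψ : Assignment n, ε := by
        rw [binExp_sum]
        refine Finset.sum_le_sum fun φ _ => ?_
        rw [binExp_sum]
        exact Finset.sum_le_sum fun ψ _ => hpair φ ψ
    _ = 4 ^ n * ε := by
        simp only [Finset.sum_const, Finset.card_univ, Fintype.card_fun, Fintype.card_bool,
          Fintype.card_fin, nsmul_eq_mul]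
        push_cast
        rw [show (4 : ℝ) = 2 * 2 by norm_num, mul_pow]
        ring
    _ ≤ 1 / (n : ℝ) ^ 2 := by
        have h4 : (4 : ℝ) ^ n ≤ Real.exp (3 * n) := by
          rw [mul_comm, Real.exp_nat_mul]
          exact pow_le_pow_left₀ (by norm_num) (by linarith [Real.add_one_le_exp (3 : ℝ)]) n
        have hlog := Real.log_le_sub_one_of_pos hn0
        calc (4 : ℝ) ^ n * ε ≤ Real.exp (3 * n) * ε := mul_le_mul_of_nonneg_right h4 hε0
          _ = Real.exp (3 * n + -(13 * (n : ℝ))) := by rw [hε, ← Real.exp_add]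
          _ ≤ Real.exp (-((2 : ℕ) * Real.log n)) := Real.exp_le_exp.2 (by push_cast; linarith)
          _ = 1 / (n : ℝ) ^ 2 := by
            rw [Real.exp_neg, Real.exp_nat_mul, Real.exp_log hn0, one_div]

/-- The weight of the connected sets of clauses of a given size. -/
theorem tree_term_le {p : ℝ} (hD : 10 ^ 8 ≤ (n : ℝ) ^ 2 * p) (hn : 0 < n) {s : ℕ}
    (hs : 0 < s) (hlog : Real.log n < 3 * (s : ℝ)) :
    (8 * n ^ 3 * (4 * (24 * n ^ 2)) ^ (s - 1) : ℝ) *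
      (8 ^ s * p ^ s * Real.exp (-((n : ℝ) ^ 2 * p / 25)) ^ s) ≤ 1 / (n : ℝ) ^ 3 := by
  have hn0 : (0 : ℝ) < n := by exact_mod_cast hn
  set D := (n : ℝ) ^ 2 * p with hDdef
  obtain ⟨m, rfl⟩ : ∃ m, s = m + 1 := ⟨s - 1, by omega⟩
  simp only [Nat.add_sub_cancel]
  -- Per clause: 96n² from the tree count, 8 from the choice of `K`, and p. The bound exp(-12) turns
  -- s > (log n)/3 into n⁻⁴, leaving n⁻³ after the root factor.
  have hbase : 768 * D * Real.exp (-(D / 25)) ≤ Real.exp (-12) := by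
    have h2 : D / 50 ≤ Real.exp (D / 50) := by linarith [Real.add_one_le_exp (D / 50)]
    have h3 : (768 * 50 : ℝ) ≤ Real.exp 16 := by
      have : (2 : ℝ) ≤ Real.exp 1 := by linarith [Real.add_one_le_exp (1 : ℝ)]
      calc (768 * 50 : ℝ) ≤ 2 ^ 16 := by norm_num
        _ ≤ Real.exp 1 ^ 16 := pow_le_pow_left₀ (by norm_num) this 16
        _ = Real.exp 16 := by rw [← Real.exp_nat_mul]; norm_num
    calc 768 * D * Real.exp (-(D / 25)) = 768 * 50 * (D / 50) * Real.exp (-(D / 25)) := by ring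
      _ ≤ Real.exp 16 * Real.exp (D / 50) * Real.exp (-(D / 25)) := by
          refine mul_le_mul_of_nonneg_right ?_ (Real.exp_pos _).le
          exact mul_le_mul h3 h2 (by linarith) (Real.exp_pos _).le
      _ = Real.exp (16 + D / 50 + -(D / 25)) := by rw [Real.exp_add, Real.exp_add]
      _ ≤ Real.exp (-12) := Real.exp_le_exp.2 (by linarith)
  calc (8 * n ^ 3 * (4 * (24 * n ^ 2)) ^ m : ℝ) *
      (8 ^ (m + 1) * p ^ (m + 1) * Real.exp (-(D / 25)) ^ (m + 1))
      = (1 / 12) * n * (768 * D * Real.exp (-(D / 25))) ^ (m + 1) := by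
        rw [hDdef, show (4 * (24 * (n : ℝ) ^ 2)) = 96 * (n : ℝ) ^ 2 by ring,
          show (768 * ((n : ℝ) ^ 2 * p) * Real.exp (-((n : ℝ) ^ 2 * p / 25))) =
            (96 * (n : ℝ) ^ 2) * 8 * p * Real.exp (-((n : ℝ) ^ 2 * p / 25)) by ring]
        simp only [mul_pow, pow_succ]
        ring
    _ ≤ n * Real.exp (-12) ^ (m + 1) := by
        have := pow_le_pow_left₀ (by positivity) hbase (m + 1)
        have h' : 0 ≤ (768 * D * Real.exp (-(D / 25))) ^ (m + 1) := by positivity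
        nlinarith [mul_le_mul_of_nonneg_left this hn0.le, mul_nonneg hn0.le h']
    _ = Real.exp (Real.log n + -(12 * ((m + 1 : ℕ) : ℝ))) := by
        rw [Real.exp_add, Real.exp_log hn0, ← Real.exp_nat_mul]
        congr 2
        ring
    _ ≤ Real.exp (-((3 : ℕ) * Real.log n)) := Real.exp_le_exp.2 (by push_cast at hlog ⊢; linarith)
    _ = 1 / (n : ℝ) ^ 3 := by rw [Real.exp_neg, Real.exp_nat_mul, Real.exp_log hn0, one_div]

open Classical in
/-- The total weight of the tree witnesses. -/
theorem sum_treeWitness_le {p q : ℝ} (h0 : 0 ≤ p) (hD : 10 ^ 8 ≤ (n : ℝ) ^ 2 * p) (hn : 0 < n)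
    (hq0 : 0 ≤ q) (hq : q ≤ Real.exp (-((n : ℝ) ^ 2 * p / 10))) :
    ∑ x ∈ (Finset.univ : Finset (Formula n × Finset (Fin n))).filter
      (fun x => IsTreeWitness x.1 x.2), p ^ x.1.card * q ^ x.2.card ≤ 1 / (n : ℝ) ^ 2 := by
  have hn0 : (0 : ℝ) < n := by exact_mod_cast hn
  set D := (n : ℝ) ^ 2 * p with hDdef
  set η := Real.exp (-(D / 25)) with hη
  set 𝒯 : Finset (Formula n) := Finset.univ.filter fun T => T ⊆ allClauses n ∧ 0 < T.card ∧
    T.card ≤ n ∧ Real.log n < 3 * (T.card : ℝ) ∧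
    ∃ C₀ ∈ allClauses n, T ∈ treeSets clauseNbrs (T.card - 1) C₀ with h𝒯
  have hcount : ∀ s, ((𝒯.filter fun T => T.card = s).card : ℝ) ≤
      8 * n ^ 3 * (4 * (24 * n ^ 2)) ^ (s - 1) := by
    intro s
    have hsub : (𝒯.filter fun T => T.card = s) ⊆
        (allClauses n).biUnion fun C₀ => treeSets clauseNbrs (s - 1) C₀ := by
      intro T hT
      simp only [h𝒯, Finset.mem_filter, Finset.mem_univ, true_and] at hT
      obtain ⟨⟨-, -, -, -, C₀, hC₀, hT⟩, rfl⟩ := hT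
      exact Finset.mem_biUnion.2 ⟨C₀, hC₀, hT⟩
    have h := (Finset.card_le_card hsub).trans (Finset.card_biUnion_le.trans
      (Finset.sum_le_sum fun C₀ _ => card_treeSets_le card_clauseNbrs_le (s - 1) C₀))
    rw [Finset.sum_const, smul_eq_mul] at h
    have h' := h.trans (Nat.mul_le_mul_right _ (card_allClauses_le n))
    exact_mod_cast h'
  have hterm : ∀ (T : Formula n) (K : Finset (Fin n)), IsTreeWitness T K → p ^ T.card * q ^ K.card ≤ p ^ T.card * η ^ T.card := by
    rintro T K ⟨-, -, -, -, -, -, hTK⟩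
    refine mul_le_mul_of_nonneg_left ?_ (by positivity)
    calc q ^ K.card ≤ Real.exp (-(D / 10)) ^ K.card := pow_le_pow_left₀ hq0 hq _
      _ = Real.exp (K.card * -(D / 10)) := (Real.exp_nat_mul _ _).symm
      _ ≤ Real.exp (T.card * -(D / 25)) := by
          refine Real.exp_le_exp.2 ?_
          have : (2 * T.card : ℝ) ≤ 5 * K.card := by exact_mod_cast hTK
          nlinarith
      _ = η ^ T.card := Real.exp_nat_mul _ _
  calc _ ≤ ∑ x ∈ (Finset.univ : Finset (Formula n × Finset (Fin n))).filter
        (fun x => IsTreeWitness x.1 x.2), p ^ x.1.card * η ^ x.1.card :=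
        Finset.sum_le_sum fun x hx => hterm _ _ (Finset.mem_filter.1 hx).2
    _ ≤ ∑ x ∈ (Finset.univ : Finset (Formula n × Finset (Fin n))).filter
        (fun x => x.1 ∈ 𝒯 ∧ x.2 ∈ x.1.vars.powerset), p ^ x.1.card * η ^ x.1.card := by
        refine Finset.sum_le_sum_of_subset_of_nonneg ?_ fun x _ _ => by positivity
        intro x hx
        obtain ⟨h1, h2, h3, h4, h5, h6, h7⟩ := (Finset.mem_filter.1 hx).2
        exact Finset.mem_filter.2 ⟨Finset.mem_univ _, Finset.mem_filter.2
          ⟨Finset.mem_univ _, h1, h2, h3, h4, h5⟩, Finset.mem_powerset.2 h6⟩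
    _ ≤ ∑ T ∈ 𝒯, 8 ^ T.card * p ^ T.card * η ^ T.card := by
        rw [Finset.sum_finset_product _ 𝒯 (fun T => T.vars.powerset) (fun x => by simp)]
        refine Finset.sum_le_sum fun T hT => ?_
        simp only [Finset.sum_const, nsmul_eq_mul, Finset.card_powerset]
        have h1 := card_formula_vars_le (Finset.mem_filter.1 hT).2.1
        have h2 : (2 : ℝ) ^ T.vars.card ≤ 8 ^ T.card := by
          calc (2 : ℝ) ^ T.vars.card ≤ 2 ^ (3 * T.card) := pow_le_pow_right₀ (by norm_num) h1
            _ = 8 ^ T.card := by rw [pow_mul]; norm_num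
        push_cast
        rw [mul_assoc]
        exact mul_le_mul_of_nonneg_right h2 (by positivity)
    _ = ∑ s ∈ Finset.Icc 1 n, ∑ T ∈ 𝒯.filter (fun T => T.card = s),
          8 ^ T.card * p ^ T.card * η ^ T.card := by
        refine (Finset.sum_fiberwise_of_maps_to (fun T hT => ?_) _).symm
        obtain ⟨-, -, h1, h2, -⟩ := Finset.mem_filter.1 hT
        exact Finset.mem_Icc.2 ⟨h1, h2⟩
    _ ≤ ∑ s ∈ Finset.Icc 1 n, 1 / (n : ℝ) ^ 3 := by
        refine Finset.sum_le_sum fun s hs => ?_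
        have hs1 := (Finset.mem_Icc.1 hs).1
        by_cases hlog : Real.log n < 3 * (s : ℝ)
        · refine le_trans ?_ (tree_term_le hD hn hs1 hlog)
          rw [Finset.sum_congr rfl fun T hT => by rw [(Finset.mem_filter.1 hT).2],
            Finset.sum_const, nsmul_eq_mul]
          exact mul_le_mul_of_nonneg_right (hcount s) (by positivity)
        · rw [Finset.sum_eq_zero]
          · positivity
          · intro T hT
            obtain ⟨hT1, hT2⟩ := Finset.mem_filter.1 hT
            obtain ⟨-, -, -, -, h1, -⟩ := Finset.mem_filter.1 hT1
            rw [hT2] at h1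
            exact absurd h1 hlog
    _ = 1 / (n : ℝ) ^ 2 := by
        rw [Finset.sum_const, Nat.card_Icc, Nat.add_sub_cancel, nsmul_eq_mul]
        field_simp

/-- The weight of the large sets of variables of low support. -/
theorem lowSupport_term_le {D q : ℝ} (hD : 10 ^ 8 ≤ D) (hn : 0 < n)
    (hq0 : 0 ≤ q) (hq : q ≤ Real.exp (-(D / 10))) {k : ℕ} (hk : 0 < k)
    (hk' : 2 / 5 * (Real.exp (-(D / 1000)) * n) ≤ k) :
    (n.choose k : ℝ) * q ^ k ≤ 1 / (n : ℝ) ^ 2 := by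
  have hn0 : (0 : ℝ) < n := by exact_mod_cast hn
  have hk0 : (1 : ℝ) ≤ k := by exact_mod_cast hk
  have hbase : Real.exp 1 * n / k * q ≤ Real.exp (-(D / 20)) := by
    have h1 : (n : ℝ) / k ≤ 5 / 2 * Real.exp (D / 1000) := by
      rw [div_le_iff₀ (by linarith)]
      have := mul_le_mul_of_nonneg_left hk' (show 0 ≤ 5 / 2 * Real.exp (D / 1000) by positivity)
      refine le_trans (le_of_eq ?_) this
      have e : Real.exp (D / 1000) * Real.exp (-(D / 1000)) = 1 := by
        rw [← Real.exp_add]; simp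
      linear_combination (-(n : ℝ)) * e
    have h2 : (5 / 2 : ℝ) ≤ Real.exp 2 := by linarith [Real.add_one_le_exp (2 : ℝ)]
    calc Real.exp 1 * n / k * q = Real.exp 1 * (n / k) * q := by ring
      _ ≤ Real.exp 1 * (Real.exp 2 * Real.exp (D / 1000)) * Real.exp (-(D / 10)) := by
          refine mul_le_mul (mul_le_mul_of_nonneg_left (h1.trans
            (mul_le_mul_of_nonneg_right h2 (Real.exp_pos _).le)) (Real.exp_pos _).le) hq hq0 ?_
          positivity
      _ = Real.exp (1 + (2 + D / 1000) + -(D / 10)) := by simp only [Real.exp_add]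
      _ ≤ _ := Real.exp_le_exp.2 (by linarith)
  -- If D ≥ 40 log n, then k ≥ 1 suffices. Otherwise exp(-D/1000)n ≥ √n, so `k` itself is of order
  -- at least √n.
  have hlog2 : 40 * Real.log n ≤ D * k := by
    by_cases h : 40 * Real.log n ≤ D
    · nlinarith
    · rw [not_le] at h
      have h1 : Real.sqrt n ≤ Real.exp (-(D / 1000)) * n := by
        have e : Real.sqrt n = Real.exp (Real.log n / 2) := by
          rw [← Real.log_sqrt hn0.le, Real.exp_log (Real.sqrt_pos.2 hn0)]
        have e2 : Real.exp (-(D / 1000)) * n = Real.exp (-(D / 1000) + Real.log n) := by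
          rw [Real.exp_add, Real.exp_log hn0]
        rw [e, e2]
        refine Real.exp_le_exp.2 ?_
        linarith
      have h2 : Real.log n ≤ 2 * Real.sqrt n := by
        have := Real.log_le_sub_one_of_pos (Real.sqrt_pos.2 hn0)
        rw [Real.log_sqrt hn0.le] at this
        linarith
      have h3 : 2 / 5 * Real.sqrt n ≤ k := by linarith
      have h4 := mul_le_mul hD h3 (by positivity) (by linarith)
      have := Real.sqrt_nonneg (n : ℝ)
      linarith
  calc (n.choose k : ℝ) * q ^ k ≤ (Real.exp 1 * n / k) ^ k * q ^ k :=
        mul_le_mul_of_nonneg_right (choose_le_exp_pow hk) (by positivity)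
    _ = (Real.exp 1 * n / k * q) ^ k := (mul_pow _ _ _).symm
    _ ≤ Real.exp (-(D / 20)) ^ k := pow_le_pow_left₀ (by positivity) hbase k
    _ = Real.exp (k * -(D / 20)) := (Real.exp_nat_mul _ _).symm
    _ ≤ Real.exp (-((2 : ℕ) * Real.log n)) := Real.exp_le_exp.2 (by push_cast; linarith)
    _ = 1 / (n : ℝ) ^ 2 := by rw [Real.exp_neg, Real.exp_nat_mul, Real.exp_log hn0, one_div]

/-- With t ≤ D/20 + 1 the exponent is at most 1.4 · (D/20 + 1) - D/5, which is below -D/10. -/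
theorem support_prob_le {p : ℝ} (h0 : 0 ≤ p) (h1 : p ≤ 1) (hD : 10 ^ 8 ≤ (n : ℝ) ^ 2 * p)
    (hM : 2 / 5 * (n : ℝ) ^ 2 ≤ (n - 1).choose 2) {t : ℕ}
    (ht : (t : ℝ) ≤ (n : ℝ) ^ 2 * p / 20 + 1) :
    (2 ^ (2 * t) * (1 - p / 2) ^ (n - 1).choose 2 : ℝ) ≤
      Real.exp (-((n : ℝ) ^ 2 * p / 10)) := by
  have h2 : (2 : ℝ) ^ (2 * t) = Real.exp ((2 * t : ℕ) * Real.log 2) := by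
    rw [Real.exp_nat_mul, Real.exp_log (by norm_num)]
  have h3 : (1 - p / 2) ^ (n - 1).choose 2 ≤ Real.exp ((n - 1).choose 2 * -(p / 2)) := by
    rw [Real.exp_nat_mul]
    exact pow_le_pow_left₀ (by linarith) (by linarith [Real.add_one_le_exp (-(p / 2))]) _
  rw [h2]
  refine (mul_le_mul_of_nonneg_left h3 (Real.exp_pos _).le).trans ?_
  rw [← Real.exp_add]
  refine Real.exp_le_exp.2 ?_
  have h4 := Real.log_two_lt_d9
  have h5 : (0 : ℝ) ≤ t := by positivity
  have h6 : (t : ℝ) * Real.log 2 ≤ t * (7 / 10) :=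
    mul_le_mul_of_nonneg_left (by linarith) h5
  have h7 := mul_le_mul_of_nonneg_right hM h0
  push_cast
  nlinarith

end UnionBounds

/-! ### The structure of the outcome -/

section Structure

variable {n : ℕ}

/-- The formulas with a satisfying assignment that has the claimed core structure. -/
def wellStructured (n : ℕ) (p c : ℝ) (t : ℕ) : Set (Formula n) :=
  {F : Formula n | ∃ (ψ : Assignment n) (H : Finset (Fin n)),
    Satisfies ψ F ∧
    IsMaximalCore F ψ t H ∧
    (1 - Real.exp (-(c * ((n : ℝ) ^ 2 * p)))) * (n : ℝ) ≤ (H.card : ℝ) ∧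
    IsProportional F ((t : ℝ) / 10) ∧
    IsFrozen F (H ∪ satellites F ψ H) ∧
    ComponentsAtMost (F.out (H ∪ satellites F ψ H) ψ) (Real.log (n : ℝ))}

-- Contrapositive of `exists_core_structure` in first-moment form: a bad outcome has either `k`
-- variables of low support or a tree witness, and so contributes at least 1 to the sum.
open Classical in
theorem one_le_of_not_wellStructured {F : Formula n} (hF : F ⊆ allClauses n) {ψ : Assignment n}
    (hψ : Satisfies ψ F) {p c : ℝ} {t : ℕ} (ht : 0 < t) (hbad : F ∉ wellStructured n p c t)
    (hprop : IsProportional F ((t : ℝ) / 10))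
    (hclose : ∀ φ, Satisfies φ F → ((disagree φ ψ).card : ℝ) ≤ (n : ℝ) / 10 ^ 6)
    (hlog : 1 ≤ Real.log n)
    (hκ : Real.exp (-(c * ((n : ℝ) ^ 2 * p))) * n + 1 ≤ (n : ℝ) / 10 ^ 6) {k : ℕ}
    (hk : (k : ℝ) ≤ 2 / 5 * (Real.exp (-(c * ((n : ℝ) ^ 2 * p))) * n) + 1) :
    1 ≤ ∑ K ∈ Finset.powersetCard k (Finset.univ : Finset (Fin n)),
        ind (∅ ⊆ F ∧ K ⊆ lowSupport F ψ (2 * t)) +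
      ∑ x ∈ (Finset.univ : Finset (Formula n × Finset (Fin n))).filter
        (fun x => IsTreeWitness x.1 x.2), ind (x.1 ⊆ F ∧ x.2 ⊆ lowSupport F ψ (2 * t)) := by
  have hn1 : ∀ s : Finset (Finset (Fin n)),
      0 ≤ ∑ K ∈ s, ind (∅ ⊆ F ∧ K ⊆ lowSupport F ψ (2 * t)) := fun s =>
    Finset.sum_nonneg fun _ _ => ind_nonneg _
  have hn2 : ∀ s : Finset (Formula n × Finset (Fin n)),
      0 ≤ ∑ x ∈ s, ind (x.1 ⊆ F ∧ x.2 ⊆ lowSupport F ψ (2 * t)) := fun s =>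
    Finset.sum_nonneg fun _ _ => ind_nonneg _
  by_cases htree : ∀ T K, IsTreeWitness T K → T ⊆ F → ¬ K ⊆ lowSupport F ψ (2 * t)
  · by_cases hlow : 5 / 2 * ((lowSupport F ψ (2 * t)).card : ℝ) ≤
        Real.exp (-(c * ((n : ℝ) ^ 2 * p))) * n
    · obtain ⟨H, h1, h2, h3, h4⟩ :=
        exists_core_structure hF hψ ht hprop hclose hlog hκ hlow htree
      exact absurd ⟨ψ, H, hψ, h1, by linarith, hprop, h3, h4⟩ hbad
    · have hk' : k ≤ (lowSupport F ψ (2 * t)).card := by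
        have : (k : ℝ) < (lowSupport F ψ (2 * t)).card + 1 := by linarith
        have : k < (lowSupport F ψ (2 * t)).card + 1 := by exact_mod_cast this
        omega
      obtain ⟨K, hK, hKc⟩ := Finset.exists_subset_card_eq hk'
      have h := Finset.single_le_sum (f := fun K => ind (∅ ⊆ F ∧ K ⊆ lowSupport F ψ (2 * t)))
        (fun _ _ => ind_nonneg _)
        (Finset.mem_powersetCard.2 ⟨Finset.subset_univ K, hKc⟩)
      rw [ind_pos ⟨Finset.empty_subset F, hK⟩] at h
      linarith [hn2 ((Finset.univ : Finset (Formula n × Finset (Fin n))).filter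
        (fun x => IsTreeWitness x.1 x.2))]
  · push Not at htree
    obtain ⟨T, K, hTK, hT, hK⟩ := htree
    have h := Finset.single_le_sum
      (s := (Finset.univ : Finset (Formula n × Finset (Fin n))).filter
        fun x => IsTreeWitness x.1 x.2)
      (f := fun x : Formula n × Finset (Fin n) => ind (x.1 ⊆ F ∧ x.2 ⊆ lowSupport F ψ (2 * t)))
      (fun _ _ => ind_nonneg _) (a := (T, K)) (Finset.mem_filter.2 ⟨Finset.mem_univ _, hTK⟩)
    rw [ind_pos ⟨hT, hK⟩] at h
    linarith [hn1 (Finset.powersetCard k (Finset.univ : Finset (Fin n)))]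

theorem two_fifths_sq_le_choose (hn : 15 ≤ n) :
    2 / 5 * (n : ℝ) ^ 2 ≤ ((n - 1).choose 2 : ℕ) := by
  obtain ⟨m, rfl⟩ : ∃ m, n = m + 1 := ⟨n - 1, by omega⟩
  rw [Nat.add_sub_cancel, Nat.cast_choose_two]
  have : (14 : ℝ) ≤ m := by exact_mod_cast (by omega : 14 ≤ m)
  push_cast
  nlinarith

theorem binExp_not_wellStructured_le (σ : ClauseOrder n) {p : ℝ} (h1 : p ≤ 1)
    (hD : 10 ^ 8 ≤ (n : ℝ) ^ 2 * p) (hn : 2 * 10 ^ 6 ≤ n) {t : ℕ}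
    (ht : (n : ℝ) ^ 2 * p / 20 ≤ t) (ht' : (t : ℝ) ≤ (n : ℝ) ^ 2 * p / 20 + 1) :
    binExp p (allClauses n) (fun S => ind (satFormula σ S ∉ wellStructured n p (1 / 1000) t)) ≤
      5 / (n : ℝ) ^ 2 := by
  classical
  have hnR : (2 * 10 ^ 6 : ℝ) ≤ n := by exact_mod_cast hn
  have hn0 : 0 < n := by omega
  have h0 : 0 ≤ p := by
    by_contra h
    nlinarith [sq_nonneg (n : ℝ)]
  have hM := two_fifths_sq_le_choose (n := n) (by omega)
  have ht0 : 0 < t := by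
    have : (0 : ℝ) < t := by linarith
    exact_mod_cast this
  have hlog : 1 ≤ Real.log n := by
    rw [Real.le_log_iff_exp_le (by linarith)]
    linarith [Real.exp_one_lt_d9]
  set D := (n : ℝ) ^ 2 * p with hDdef
  set κ := Real.exp (-(1 / 1000 * D)) * n with hκdef
  have hκ : κ + 1 ≤ (n : ℝ) / 10 ^ 6 := by
    have h2 : (2 * 10 ^ 6 : ℝ) ≤ Real.exp (1 / 1000 * D) := by
      have := Real.quadratic_le_exp_of_nonneg (x := 1 / 1000 * D) (by linarith)
      nlinarith
    have h3 : Real.exp (-(1 / 1000 * D)) ≤ 1 / (2 * 10 ^ 6) := by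
      rw [Real.exp_neg, ← one_div]
      exact one_div_le_one_div_of_le (by norm_num) h2
    have h4 := mul_le_mul_of_nonneg_right h3 (show (0 : ℝ) ≤ n by linarith)
    rw [← hκdef] at h4
    linarith
  have hκ0 : 0 ≤ κ := by positivity
  -- The least integer exceeding 2κ/5: more than 2κ/5 variables of low support contain a `k`-subset.
  set k := ⌊2 / 5 * κ⌋₊ + 1 with hk
  have hk1 : (k : ℝ) ≤ 2 / 5 * κ + 1 := by
    rw [hk]
    push_cast
    linarith [Nat.floor_le (show 0 ≤ 2 / 5 * κ by positivity)]
  have hk2 : 2 / 5 * κ ≤ k := by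
    rw [hk]
    push_cast
    exact (Nat.lt_floor_add_one _).le
  set W := (Finset.univ : Finset (Formula n × Finset (Fin n))).filter
    (fun x => IsTreeWitness x.1 x.2) with hW
  set 𝒦 := Finset.powersetCard k (Finset.univ : Finset (Fin n)) with h𝒦
  set q : ℝ := 2 ^ (2 * t) * (1 - p / 2) ^ (n - 1).choose 2 with hq
  have hq0 : 0 ≤ q := mul_nonneg (by positivity) (pow_nonneg (by linarith) _)
  have hq1 : q ≤ Real.exp (-(D / 10)) := support_prob_le h0 h1 hD hM ht'
  set w : Finset (Clause n) → Assignment n → Formula n → Finset (Fin n) → ℝ := fun S ψ T K =>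
    solutionWeight ψ (satFormula σ S) *
      ind (T ⊆ satFormula σ S ∧ K ⊆ lowSupport (satFormula σ S) ψ (2 * t)) with hw
  have hpoint : ∀ S ⊆ allClauses n, ind (satFormula σ S ∉ wellStructured n p (1 / 1000) t) ≤
      ind (¬ IsProportional (satFormula σ S) ((t : ℝ) / 10)) +
      ind (∃ φ ψ, Satisfies φ (satFormula σ S) ∧
        Satisfies ψ (satFormula σ S) ∧ (n : ℝ) / 10 ^ 6 < (disagree φ ψ).card) +
      (∑ K ∈ 𝒦, ∑ ψ, w S ψ ∅ K + ∑ x ∈ W, ∑ ψ, w S ψ x.1 x.2) := by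
    intro S hS
    have hw0 : ∀ ψ T K, 0 ≤ w S ψ T K := fun ψ T K =>
      mul_nonneg (solutionWeight_nonneg _ _) (ind_nonneg _)
    have hs1 : 0 ≤ ∑ K ∈ 𝒦, ∑ ψ, w S ψ ∅ K :=
      Finset.sum_nonneg fun _ _ => Finset.sum_nonneg fun _ _ => hw0 _ _ _
    have hs2 : 0 ≤ ∑ x ∈ W, ∑ ψ, w S ψ x.1 x.2 :=
      Finset.sum_nonneg fun _ _ => Finset.sum_nonneg fun _ _ => hw0 _ _ _
    have hi1 := ind_nonneg (¬ IsProportional (satFormula σ S) ((t : ℝ) / 10))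
    have hi2 := ind_nonneg (∃ φ ψ, Satisfies φ (satFormula σ S) ∧
        Satisfies ψ (satFormula σ S) ∧ (n : ℝ) / 10 ^ 6 < (disagree φ ψ).card)
    refine ind_le (by linarith) fun hbad => ?_
    by_cases hprop : IsProportional (satFormula σ S) ((t : ℝ) / 10)
    · by_cases hfar : ∃ φ ψ, Satisfies φ (satFormula σ S) ∧
        Satisfies ψ (satFormula σ S) ∧ (n : ℝ) / 10 ^ 6 < (disagree φ ψ).card
      · rw [ind_pos hfar]
        linarith
      · have hF := (satFormula_subset σ S).trans hS
        -- A bad outcome fails for every one of its solutions, so the average over a random solution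
        -- is still at least 1.
        have hsum : 1 ≤ ∑ K ∈ 𝒦, ∑ ψ, w S ψ ∅ K + ∑ x ∈ W, ∑ ψ, w S ψ x.1 x.2 := by
          rw [Finset.sum_comm, Finset.sum_comm (s := W), ← Finset.sum_add_distrib,
            ← sum_solutionWeight (satisfiable_satFormula σ S)]
          refine Finset.sum_le_sum fun ψ _ => ?_
          simp only [hw]
          rw [← Finset.mul_sum, ← Finset.mul_sum, ← mul_add]
          by_cases hψ : Satisfies ψ (satFormula σ S)
          · refine le_mul_of_one_le_right (solutionWeight_nonneg _ _) ?_
            refine one_le_of_not_wellStructured hF hψ ht0 hbad hprop (fun φ hφ => ?_) hlog hκ hk1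
            by_contra hlt
            exact hfar ⟨φ, ψ, hφ, hψ, not_le.1 hlt⟩
          · rw [show solutionWeight ψ (satFormula σ S) = 0 from if_neg hψ, zero_mul]
        linarith
    · rw [ind_pos hprop]
      linarith
  have hP1 := binExp_not_proportional_le σ h0 h1 hD (ρ := (t : ℝ) / 10) (by linarith) hn0
  have hP2 := binExp_far_solutions_le σ h0 h1 hD hn0 hM
  have hterm : ∀ T ⊆ allClauses n, ∀ K, binExp p (allClauses n) (fun S => ∑ ψ, w S ψ T K) ≤
      p ^ T.card * q ^ K.card := by
    intro T hT K
    rw [binExp_sum]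
    exact sum_binExp_lowSupport_le σ h0 h1 hT K (2 * t)
  have hP3 : binExp p (allClauses n) (fun S => ∑ K ∈ 𝒦, ∑ ψ, w S ψ ∅ K) ≤ 1 / (n : ℝ) ^ 2 := by
    rw [binExp_sum]
    calc _ ≤ ∑ K ∈ 𝒦, q ^ k := by
          refine Finset.sum_le_sum fun K hK => ?_
          have h := hterm ∅ (Finset.empty_subset _) K
          rwa [Finset.card_empty, pow_zero, one_mul, (Finset.mem_powersetCard.1 hK).2] at h
      _ = (n.choose k : ℝ) * q ^ k := by
          rw [Finset.sum_const, h𝒦, Finset.card_powersetCard, Finset.card_univ, Fintype.card_fin,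
            nsmul_eq_mul]
      _ ≤ _ := lowSupport_term_le hD hn0 hq0 hq1 (Nat.succ_pos _) (by
          rw [show D / 1000 = 1 / 1000 * D by ring]
          exact hk2)
  have hP4 : binExp p (allClauses n) (fun S => ∑ x ∈ W, ∑ ψ, w S ψ x.1 x.2) ≤
      1 / (n : ℝ) ^ 2 := by
    rw [binExp_sum]
    refine (Finset.sum_le_sum fun x hx => ?_).trans (sum_treeWitness_le h0 hD hn0 hq0 hq1)
    exact hterm x.1 (Finset.mem_filter.1 hx).2.1 x.2
  refine (binExp_mono h0 h1 hpoint).trans ?_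
  rw [binExp_add, binExp_add, binExp_add]
  refine (add_le_add (add_le_add hP1 hP2) (add_le_add hP3 hP4)).trans (le_of_eq ?_)
  ring

/-! ### Averaging over the clause order -/

theorem satProb_eq (n : ℕ) (p : ℝ) (A : Set (Formula n)) :
    satProb n p A = (∑ σ : ClauseOrder n, binExp p (allClauses n)
      fun S => ind (satFormula σ S ∈ A)) / (Fintype.card (ClauseOrder n) : ℝ) := by
  unfold satProb binExp binWeight ind
  rfl

theorem one_sub_satProb_eq (n : ℕ) (p : ℝ) (A : Set (Formula n)) :
    1 - satProb n p A = (∑ σ : ClauseOrder n, binExp p (allClauses n)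
      fun S => ind (satFormula σ S ∉ A)) / (Fintype.card (ClauseOrder n) : ℝ) := by
  have hne : Nonempty (ClauseOrder n) :=
    ⟨(Fintype.equivFinOfCardEq (Fintype.card_coe (allClauses n))).symm⟩
  have hc : (Fintype.card (ClauseOrder n) : ℝ) ≠ 0 := Nat.cast_ne_zero.2 Fintype.card_ne_zero
  have h : ∀ σ : ClauseOrder n, binExp p (allClauses n) (fun S => ind (satFormula σ S ∉ A)) =
      1 - binExp p (allClauses n) (fun S => ind (satFormula σ S ∈ A)) := fun σ => by
    rw [← binExp_one p (allClauses n), ← binExp_sub]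
    refine binExp_congr fun S _ => ?_
    by_cases hA : satFormula σ S ∈ A
    · rw [ind_neg (not_not.2 hA), ind_pos hA, sub_self]
    · rw [ind_pos hA, ind_neg hA, sub_zero]
  rw [satProb_eq, Finset.sum_congr rfl fun σ _ => h σ, Finset.sum_sub_distrib, Finset.sum_const,
    Finset.card_univ, nsmul_eq_mul, mul_one, sub_div, div_self hc]

theorem abs_one_sub_satProb_le {p : ℝ} (h1 : p ≤ 1)
    (hD : 10 ^ 8 ≤ (n : ℝ) ^ 2 * p) (hn : 2 * 10 ^ 6 ≤ n) {t : ℕ}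
    (ht : (n : ℝ) ^ 2 * p / 20 ≤ t) (ht' : (t : ℝ) ≤ (n : ℝ) ^ 2 * p / 20 + 1) :
    |1 - satProb n p (wellStructured n p (1 / 1000) t)| ≤ 5 / (n : ℝ) ^ 2 := by
  have h0 : 0 ≤ p := by
    by_contra h
    nlinarith [sq_nonneg (n : ℝ)]
  rw [one_sub_satProb_eq, abs_of_nonneg]
  · refine div_le_of_le_mul₀ (by positivity) (by positivity) ?_
    refine (Finset.sum_le_sum fun σ _ => binExp_not_wellStructured_le σ h1 hD hn ht ht').trans
      (le_of_eq ?_)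
    rw [Finset.sum_const, Finset.card_univ, nsmul_eq_mul, mul_comm]
  · exact div_nonneg (Finset.sum_nonneg fun σ _ => binExp_nonneg h0 h1 fun S _ => ind_nonneg _)
      (by positivity)

end Structure

end RandomSat

/-! ### Asymptotics -/

theorem mainTheorem5 :
    ∃ d c : ℝ, 0 < d ∧ 0 < c ∧ ∃ t : ℕ → ℝ → ℕ, (∀ (n : ℕ) (q : ℝ), 0 < t n q) ∧
      ∀ p : ℕ → ℝ, (∀ᶠ n : ℕ in atTop, d ≤ (n : ℝ) ^ 2 * p n ∧ p n ≤ 1) →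
        (fun n : ℕ => 1 - satProb n (p n)
          {F : Formula n | ∃ (ψ : Assignment n) (H : Finset (Fin n)),
            Satisfies ψ F ∧
            IsMaximalCore F ψ (t n (p n)) H ∧
            (1 - Real.exp (-(c * ((n : ℝ) ^ 2 * p n)))) * (n : ℝ) ≤ (H.card : ℝ) ∧
            IsProportional F ((t n (p n) : ℝ) / 10) ∧
            IsFrozen F (H ∪ satellites F ψ H) ∧
            ComponentsAtMost (F.out (H ∪ satellites F ψ H) ψ) (Real.log (n : ℝ))})
        =o[atTop]
          (fun n : ℕ => 1 / Real.sqrt (p n * (8 * (n.choose 3 : ℝ)))) := by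
  refine ⟨10 ^ 8, 1 / 1000, by norm_num, by norm_num,
    -- The `+ 1` makes t positive and places it between D/20 and D/20 + 1 when D ≥ 0.
    fun n q => ⌊(n : ℝ) ^ 2 * q / 20⌋₊ + 1, fun _ _ => Nat.succ_pos _, fun p hp => ?_⟩
  have hsq : (fun n : ℕ => 1 / (n : ℝ) ^ 2) =o[atTop]
      (fun n : ℕ => 1 / (3 * ((n : ℝ) * Real.sqrt n))) := by
    rw [isLittleO_iff_tendsto' ?_]
    · have h : Tendsto (fun n : ℕ => 3 * (Real.sqrt (n : ℝ))⁻¹) atTop (nhds (3 * 0)) :=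
        ((Real.tendsto_sqrt_atTop.comp tendsto_natCast_atTop_atTop).inv_tendsto_atTop).const_mul 3
      rw [mul_zero] at h
      refine h.congr' ?_
      filter_upwards [eventually_gt_atTop 0] with n hn
      have hn0 : (0 : ℝ) < n := by exact_mod_cast hn
      have hs := Real.sqrt_pos.2 hn0
      have hss := Real.mul_self_sqrt hn0.le
      field_simp
      nlinarith
    · filter_upwards [eventually_gt_atTop 0] with n hn h
      have hn0 : (0 : ℝ) < n := by exact_mod_cast hn
      have hs := Real.sqrt_pos.2 hn0
      exact absurd h (by positivity)
  -- The failure probability is O(n⁻²), and √m ≤ 3n^(3/2) because p ≤ 1 and m ≤ 8n³.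
  refine IsBigO.trans_isLittleO ?_ (hsq.trans_isBigO ?_)
  · refine IsBigO.of_bound 5 ?_
    filter_upwards [hp, eventually_ge_atTop (2 * 10 ^ 6)] with n hn hn'
    rw [Real.norm_eq_abs, Real.norm_of_nonneg (by positivity), mul_one_div]
    refine abs_one_sub_satProb_le hn.2 hn.1 hn' ?_ ?_
    · push_cast
      exact (Nat.lt_floor_add_one _).le
    · push_cast
      linarith [Nat.floor_le (show 0 ≤ (n : ℝ) ^ 2 * p n / 20 by linarith [hn.1])]
  · refine IsBigO.of_bound 1 ?_
    filter_upwards [hp, eventually_ge_atTop 3] with n hn hn'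
    have hn0 : (0 : ℝ) < n := by exact_mod_cast (by omega : 0 < n)
    have hp0 : 0 < p n := by
      by_contra h
      nlinarith [hn.1, sq_nonneg (n : ℝ)]
    have hc : (0 : ℝ) < n.choose 3 := by exact_mod_cast Nat.choose_pos hn'
    have hc3 : (n.choose 3 : ℝ) ≤ (n : ℝ) ^ 3 := by exact_mod_cast Nat.choose_le_pow n 3
    rw [Real.norm_of_nonneg (by positivity), Real.norm_of_nonneg (by positivity), one_mul]
    refine one_div_le_one_div_of_le (Real.sqrt_pos.2 (by positivity)) ?_
    rw [Real.sqrt_le_left (by positivity)]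
    rw [mul_pow, mul_pow, Real.sq_sqrt hn0.le]
    calc p n * (8 * (n.choose 3 : ℝ)) ≤ 1 * (8 * (n : ℝ) ^ 3) :=
          mul_le_mul hn.2 (by linarith) (by positivity) zero_le_one
      _ ≤ _ := by nlinarith [pow_pos hn0 3]
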